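/- **Uniqueness for the inverse absorption problem.** Let $d\ge 1$, $T>0$, and let $\Omega\subset\mathbb R^d$ be an open convex set with smooth boundary and outward unit normal $\mathbf n_{\mathbf x}$. Put $X=(0,T)\times\Omega\times\mathbb S^{d-1}$, $X_0=\Omega\times\mathbb S^{d-1}$ and $\Gamma_\pm=\{(z,\mathbf x,\mathbf k)\in(0,T)\times\partial\Omega\times\mathbb S^{d-1}:\ \pm\,\mathbf n_{\mathbf x}\cdot\mathbf k>0\}$. Write $\langle u\rangle(z,\mathbf x)=\int_{\mathbb S^{d-1}}u(z,\mathbf x,\mathbf k)\,d\mathbf k$ and $\mathcal K u(z,\mathbf x,\mathbf k)=\int_{\mathbb S^{d-1}}p(\mathbf k\cdot\mathbf k')\,u(z,\mathbf x,\mathbf k')\,d\mathbf k'$, where $d\mathbf k$ is the surface measure, and the measurable phase function $p$ satisfies $\underline\theta\le p(\mathbf k\cdot\mathbf k')\le\overline\theta$ for some constants $0<\underline\theta\le\overline\theta<\infty$ and $\int_{\mathbb S^{d-1}}p(\mathbf k\cdot\mathbf k')\,d\mathbf k'=1$ for all $\mathbf k$. Let $\Sigma_s>0$ be a constant and let $f\in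 L^\infty(X_0)$ with $f>0$ almost everywhere (in particular $f$ may depend on $\mathbf x$ only). Let $L\ge 0$ and consider two polynomial absorption laws $$\Sigma_a(m)(z,\mathbf x)=\sum_{l=0}^{L}\Sigma_{a,l}(z,\mathbf x)\,m(z,\mathbf x)^l,\qquad \widetilde\Sigma_a(m)(z,\mathbf x)=\sum_{l=0}^{L}\widetilde\Sigma_{a,l}(z,\mathbf x)\,m(z,\mathbf x)^l$$ with non-negative coefficients $\Sigma_{a,l},\widetilde\Sigma_{a,l}\in L^\infty((0,T)\times\Omega)$. Consider the problem $$\partial_z u+\mathbf k\cdot\nabla u+\Sigma_a(\langle u\rangle)\,u+\Sigma_s(u-\mathcal K u)=0\ \text{ in }X,\qquad u=0\ \text{ on }\Gamma_-,\qquad u(0,\cdot,\cdot)=f\ \text{ on }X_0. \tag{1}$$ A solution of (1) is a function $u\in L^\infty(X)$ that has a weak transport derivative $v=\partial_zu+\mathbf k\cdot\nabla u\in L^\infty(X)$, satisfies the equation almost everywhere in $X$, and takes its initial and inflow values in the sense of Green's formula: $$\int_X u\,(\partial_z\varphi+\mathbf k\cdot\nabla\varphi)\,dz\,d\mathbf x\,d\mathbf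 k=-\int_X v\,\varphi\,dz\,d\mathbf x\,d\mathbf k-\int_{X_0}f\,\varphi(0,\cdot,\cdot)\,d\mathbf x\,d\mathbf k$$ for all restrictions $\varphi$ of functions in $C_c^\infty(\mathbb R\times\mathbb R^d\times\mathbb R^d)$ that vanish on $\{T\}\times X_0$ and on $\Gamma_+$. Let $u$ be an almost everywhere positive solution of (1), and let $\widetilde u$ be an almost everywhere positive solution of (1) with $\widetilde\Sigma_a$ in place of $\Sigma_a$ and with the same $\Omega,T,\Sigma_s,p,f$. If the data $g=\langle u\rangle$ and $\widetilde g=\langle\widetilde u\rangle$ agree almost everywhere in $(0,T)\times\Omega$, then $$\Sigma_a(\langle u\rangle)=\widetilde\Sigma_a(\langle\widetilde u\rangle)\quad\text{almost everywhere in }(0,T)\times\Omega .$$ -/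

import Mathlib

open MeasureTheory

namespace TransportInverse

/-- The transverse space `ℝ^d` with its Euclidean norm. -/
abbrev Space (d : ℕ) : Type := EuclideanSpace ℝ (Fin d)

/-- The unit sphere `S^{d-1}` of `ℝ^d`. -/
abbrev Dir (d : ℕ) : Type := Metric.sphere (0 : Space d) 1

/-- The (unnormalised) surface measure `dk` on `S^{d-1}`. -/
noncomputable def dirMeasure (d : ℕ) : Measure (Dir d) :=
  (volume : Measure (Space d)).toSphere

/-- Lebesgue measure `dz dx` on `(0,T) × Ω`. -/
noncomputable def spaceTimeMeasure {d : ℕ} (Ω : Set (Space d)) (T : ℝ) :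
    Measure (ℝ × Space d) :=
  ((volume : Measure ℝ).restrict (Set.Ioo 0 T)).prod ((volume : Measure (Space d)).restrict Ω)

/-- The measure `dx dk` on `X₀ = Ω × S^{d-1}`. -/
noncomputable def initialMeasure {d : ℕ} (Ω : Set (Space d)) : Measure (Space d × Dir d) :=
  ((volume : Measure (Space d)).restrict Ω).prod (dirMeasure d)

/-- The measure `dz dx dk` on `X = (0,T) × Ω × S^{d-1}`. -/
noncomputable def phaseMeasure {d : ℕ} (Ω : Set (Space d)) (T : ℝ) :
    Measure (ℝ × Space d × Dir d) :=
  ((volume : Measure ℝ).restrict (Set.Ioo 0 T)).prod (initialMeasure Ω)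

/-- `Ω` has a smooth boundary: near each boundary point it is the sublevel set `{ψ < 0}` of a
smooth function `ψ` whose differential does not vanish there. -/
def HasSmoothBoundary {d : ℕ} (Ω : Set (Space d)) : Prop :=
  ∀ x ∈ frontier Ω, ∃ (U : Set (Space d)) (ψ : Space d → ℝ),
    IsOpen U ∧ x ∈ U ∧ ContDiff ℝ ((⊤ : ℕ∞) : WithTop ℕ∞) ψ ∧ fderiv ℝ ψ x ≠ 0 ∧
      ∀ y ∈ U, y ∈ Ω ↔ ψ y < 0

/-- `n` is an outward unit normal at `x` to the convex set `Ω`, that is, the unit normal of a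
supporting hyperplane, pointing away from `Ω`. For `Ω` open and convex with smooth boundary
there is exactly one such vector at each boundary point, the usual outward unit normal. -/
def IsOutwardUnitNormal {d : ℕ} (Ω : Set (Space d)) (x n : Space d) : Prop :=
  ‖n‖ = 1 ∧ ∀ y ∈ Ω, inner ℝ n (y - x) ≤ 0

/-- The angular average `⟨u⟩(z, x) = ∫ u(z, x, k) dk`. -/
noncomputable def angularAverage {d : ℕ} (u : ℝ × Space d × Dir d → ℝ) (q : ℝ × Space d) : ℝ :=
  ∫ k, u (q.1, q.2, k) ∂(dirMeasure d)

/-- The scattering operator `(K u)(z, x, k) = ∫ p(k · k') u(z, x, k') dk'`. -/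
noncomputable def scattering {d : ℕ} (p : ℝ → ℝ) (u : ℝ × Space d × Dir d → ℝ)
    (y : ℝ × Space d × Dir d) : ℝ :=
  ∫ k', p (inner ℝ (y.2.2 : Space d) (k' : Space d)) * u (y.1, y.2.1, k') ∂(dirMeasure d)

/-- The polynomial absorption law `Σ_a(m)(z, x) = ∑_{l=0}^{L} σ_l(z, x) m(z, x)^l`. -/
noncomputable def absorption {d : ℕ} {L : ℕ} (σ : Fin (L + 1) → ℝ × Space d → ℝ)
    (m : ℝ × Space d → ℝ) (q : ℝ × Space d) : ℝ :=
  ∑ l : Fin (L + 1), σ l q * m q ^ (l : ℕ)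

/-- The derivative `(∂_z + k · ∇_x) φ` at `(z, x, k)` of a function on the ambient space. -/
noncomputable def transportDeriv {d : ℕ} (φ : ℝ × Space d × Space d → ℝ)
    (y : ℝ × Space d × Dir d) : ℝ :=
  fderiv ℝ φ (y.1, y.2.1, (y.2.2 : Space d)) (1, (y.2.2 : Space d), 0)

/-- Test functions: smooth, compactly supported in the ambient space `ℝ × ℝ^d × ℝ^d`, not
required to vanish at `z = 0` or on the inflow boundary `Γ₋`, but vanishing at `z = T` and on the
outflow boundary `Γ₊ = {(z, x, k) : 0 < z < T, x ∈ ∂Ω, |k| = 1, n_x · k > 0}`. -/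
structure IsTestFunction {d : ℕ} (Ω : Set (Space d)) (T : ℝ)
    (φ : ℝ × Space d × Space d → ℝ) : Prop where
  smooth : ContDiff ℝ ((⊤ : ℕ∞) : WithTop ℕ∞) φ
  compact_support : HasCompactSupport φ
  final : ∀ x ∈ Ω, ∀ k : Dir d, φ (T, x, (k : Space d)) = 0
  outflow : ∀ z ∈ Set.Ioo 0 T, ∀ x ∈ frontier Ω, ∀ (k : Dir d) (n : Space d),
    IsOutwardUnitNormal Ω x n → 0 < inner ℝ n (k : Space d) → φ (z, x, (k : Space d)) = 0

/-- `u` has the weak transport derivative `∂_z u + k · ∇_x u = v` in `X`, the initial trace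
`u(0, ·, ·) = f` on `X₀` and the inflow trace `u = 0` on `Γ₋`, in the sense of Green's formula
`∫_X u (∂_z φ + k · ∇_x φ) = - ∫_X v φ - ∫_{X₀} f φ(0, ·, ·)` (there is no term on `Γ₋`, and none
at `z = T` or on `Γ₊`, where `φ` vanishes). -/
def HasTransportDerivAndTraces {d : ℕ} (Ω : Set (Space d)) (T : ℝ)
    (u v : ℝ × Space d × Dir d → ℝ) (f : Space d × Dir d → ℝ) : Prop :=
  ∀ φ : ℝ × Space d × Space d → ℝ, IsTestFunction Ω T φ →
    ∫ y, u y * transportDeriv φ y ∂(phaseMeasure Ω T) =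
      - ∫ y, v y * φ (y.1, y.2.1, (y.2.2 : Space d)) ∂(phaseMeasure Ω T)
      - ∫ w, f w * φ (0, w.1, (w.2 : Space d)) ∂(initialMeasure Ω)

/-- `u ∈ W_∞` solves
`∂_z u + k · ∇_x u + Σ_a(⟨u⟩) u + Σ_s (u - K u) = 0` in `X`, `u = 0` on `Γ₋`, `u = f` at `z = 0`:
`u` and its weak transport derivative are in `L^∞(X)`, the equation holds almost everywhere in
`X`, and the initial and inflow traces are `f` and `0`. -/
def IsSolution {d : ℕ} (Ω : Set (Space d)) (T : ℝ) {L : ℕ} (σ : Fin (L + 1) → ℝ × Space d → ℝ)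
    (Ss : ℝ) (p : ℝ → ℝ) (f : Space d × Dir d → ℝ) (u : ℝ × Space d × Dir d → ℝ) : Prop :=
  MemLp u ⊤ (phaseMeasure Ω T) ∧
  ∃ v : ℝ × Space d × Dir d → ℝ,
    MemLp v ⊤ (phaseMeasure Ω T) ∧
    HasTransportDerivAndTraces Ω T u v f ∧
    ∀ᵐ y ∂(phaseMeasure Ω T),
      v y + absorption σ (angularAverage u) (y.1, y.2.1) * u y
        + Ss * (u y - scattering p u y) = 0

/-- Admissible absorption coefficients: each `σ_l` is measurable, essentially bounded and
non-negative on `(0,T) × Ω`. -/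
def IsAdmissibleAbsorption {d : ℕ} (Ω : Set (Space d)) (T : ℝ) {L : ℕ}
    (σ : Fin (L + 1) → ℝ × Space d → ℝ) : Prop :=
  ∀ l, MemLp (σ l) ⊤ (spaceTimeMeasure Ω T) ∧ ∀ᵐ q ∂(spaceTimeMeasure Ω T), 0 ≤ σ l q

/-- Admissible scattering phase functions `p(k · k')` on `S^{d-1}`: measurable, bounded below and
above by positive constants, and normalised by `∫ p(k · k') dk' = 1`. -/
def IsPhaseFunction (d : ℕ) (p : ℝ → ℝ) : Prop :=
  Measurable p ∧
  (∃ θ₁ θ₂ : ℝ, 0 < θ₁ ∧ ∀ k k' : Dir d,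
    θ₁ ≤ p (inner ℝ (k : Space d) (k' : Space d)) ∧
      p (inner ℝ (k : Space d) (k' : Space d)) ≤ θ₂) ∧
  ∀ k : Dir d, ∫ k' : Dir d, p (inner ℝ (k : Space d) (k' : Space d)) ∂(dirMeasure d) = 1

end TransportInverse

/-!
The coefficient is recovered because the solution itself is: if two solutions `u` and `w` with
absorptions `a` and `b` have the same initial value, zero inflow and the same angular average, then
`u = w`. The two transport derivatives then agree, so that `(a - b) u = 0`, and `u > 0` gives
`a = b`.

Equality of `u` and `w` follows from the relative entropy `H = w log (w / u) - w + u`. Scattering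
with a symmetric kernel of unit mass dissipates it (`collision_le_relEntropy_sub`,
`integral_collision_le_zero`). Absorption contributes `- b w log (w / u) - a (u - w)`, whose angular
integral is `- b ⟨H⟩ ≤ 0`, precisely because `⟨u⟩ = ⟨w⟩`. As `H = 0` on the initial and inflow
boundary and `H ≥ 0` on the outflow boundary, `H` vanishes identically. Neither solution is bounded
below, so the entropy is taken of `w + δ` and `u + δ`; this costs an error of order `δ log (1 / δ)`
(`integral_entropyProduction_le`), which disappears in the limit, while `H` stays above a fixed
multiple of `(w - u) ^ 2` (`sq_sub_le_relEntropy`). The domain may be unbounded, and integrability is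
restored by a weight that decreases along all characteristics (`decayWeight`).

The chain rule for `H` is justified along characteristic lines. Test functions obtained by
integrating a source forward along these lines are admissible in Green's formula, since a line that
leaves through the outflow boundary does not come back. They show that a weak solution is almost
everywhere the sum of its entry value and the integral of its transport derivative
(`ae_eq_add_integral_alongLines`). On each line the entropy balance
(`integral_relEntropy_le`) is then calculus of absolutely continuous functions of one variable.
-/

namespace TransportInverse

/-! ### The relative entropy of two positive numbers -/

/-- The relative entropy density `b log (b / a) - b + a` of `b > 0` with respect to `a > 0`. -/
noncomputable def relEntropy (b a : ℝ) : ℝ := b * (Real.log b - Real.log a) - b + a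

theorem relEntropy_self (a : ℝ) : relEntropy a a = 0 := by simp [relEntropy]

/-- The relative entropy dominates the squared Hellinger distance, hence the squared difference. -/
theorem sq_sub_le_relEntropy {a b M : ℝ} (ha : 0 < a) (hb : 0 < b) (haM : a ≤ M) (hbM : b ≤ M) :
    (b - a) ^ 2 ≤ 4 * M * relEntropy b a := by
  set x := √a with hx
  set y := √b with hy
  have hx0 : 0 < x := Real.sqrt_pos.2 ha
  have hy0 : 0 < y := Real.sqrt_pos.2 hb
  have hxa : x ^ 2 = a := Real.sq_sqrt ha.le
  have hyb : y ^ 2 = b := Real.sq_sqrt hb.le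
  have hlog : Real.log (x / y) ≤ x / y - 1 := Real.log_le_sub_one_of_pos (by positivity)
  rw [Real.log_div hx0.ne' hy0.ne'] at hlog
  have h1 : (y - x) ^ 2 ≤ relEntropy b a := by
    have h2 : y ^ 2 * (Real.log x - Real.log y) ≤ y ^ 2 * (x / y - 1) := by gcongr
    have h3 : y ^ 2 * (x / y - 1) = x * y - y ^ 2 := by field_simp
    rw [relEntropy, ← hxa, ← hyb, Real.log_pow, Real.log_pow]
    push_cast
    nlinarith
  have h4 : (x + y) ^ 2 ≤ 4 * M := by nlinarith [sq_nonneg (x - y)]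
  calc (b - a) ^ 2 = (x + y) ^ 2 * (y - x) ^ 2 := by rw [← hxa, ← hyb]; ring
    _ ≤ 4 * M * relEntropy b a := by
        apply mul_le_mul h4 h1 (by positivity)
        linarith

theorem relEntropy_nonneg {a b : ℝ} (ha : 0 < a) (hb : 0 < b) : 0 ≤ relEntropy b a := by
  have h := sq_sub_le_relEntropy ha hb (le_max_left a b) (le_max_right a b)
  have hM : 0 < max a b := lt_max_of_lt_left ha
  by_contra hneg
  push Not at hneg
  nlinarith [sq_nonneg (b - a), mul_neg_of_pos_of_neg hM hneg]

/-- A collision replacing the pair `(b, a)` by `(b', a')` changes the relative entropy at first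
order by at most the difference of the two relative entropies. This is what makes the scattering
operator dissipate the relative entropy. -/
theorem collision_le_relEntropy_sub {a b a' b' : ℝ} (ha : 0 < a) (hb : 0 < b) (ha' : 0 < a')
    (hb' : 0 < b') :
    (Real.log b - Real.log a) * (b' - b) + (1 - b / a) * (a' - a) ≤
      relEntropy b' a' - relEntropy b a := by
  have hlog : Real.log ((b / a) * (a' / b')) ≤ (b / a) * (a' / b') - 1 :=
    Real.log_le_sub_one_of_pos (by positivity)
  rw [Real.log_mul (by positivity) (by positivity), Real.log_div hb.ne' ha.ne',
    Real.log_div ha'.ne' hb'.ne'] at hlog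
  have h := mul_le_mul_of_nonneg_left hlog hb'.le
  have h1 : b' * ((b / a) * (a' / b') - 1) = (b / a) * a' - b' := by field_simp
  have h2 : b / a * a = b := by field_simp
  rw [h1] at h
  simp only [relEntropy]
  linear_combination h + h2

/-! ### Entropy balance along one characteristic line -/

theorem _root_.AbsolutelyContinuousOnInterval.lipschitzOnWith_comp {A F : ℝ → ℝ} {a b : ℝ}
    {K : NNReal} {s : Set ℝ} (hA : AbsolutelyContinuousOnInterval A a b)
    (hF : LipschitzOnWith K F s) (hs : Set.MapsTo A (Set.uIcc a b) s) :
    AbsolutelyContinuousOnInterval (fun x => F (A x)) a b := by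
  rw [absolutelyContinuousOnInterval_iff] at hA ⊢
  intro ε hε
  obtain ⟨δ, hδ, h⟩ := hA (ε / (K + 1)) (by positivity)
  refine ⟨δ, hδ, fun E hE hEδ => ?_⟩
  calc ∑ i ∈ Finset.range E.1, dist (F (A (E.2 i).1)) (F (A (E.2 i).2))
      ≤ ∑ i ∈ Finset.range E.1, K * dist (A (E.2 i).1) (A (E.2 i).2) :=
        Finset.sum_le_sum fun i hi =>
          hF.dist_le_mul _ (hs (hE.1 i hi).1) _ (hs (hE.1 i hi).2)
    _ = K * ∑ i ∈ Finset.range E.1, dist (A (E.2 i).1) (A (E.2 i).2) := by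
        rw [Finset.mul_sum]
    _ ≤ K * (ε / (K + 1)) := by gcongr; exact (h E hE hEδ).le
    _ < (K + 1) * (ε / (K + 1)) := by gcongr; linarith
    _ = ε := by field

theorem hasDerivAt_min_zero_sq (x : ℝ) :
    HasDerivAt (fun y : ℝ => min y 0 * min y 0) (2 * min x 0) x := by
  rcases lt_trichotomy x 0 with hx | hx | hx
  · have h : HasDerivAt (fun y : ℝ => y * y) (2 * min x 0) x := by
      have := (hasDerivAt_id x).mul (hasDerivAt_id x)
      refine this.congr_deriv ?_
      simp [min_eq_left hx.le]; ring
    refine h.congr_of_eventuallyEq ?_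
    filter_upwards [eventually_lt_nhds hx] with y hy
    simp [min_eq_left hy.le]
  · subst hx
    rw [hasDerivAt_iff_isLittleO]
    simp only [min_self, mul_zero, sub_zero, smul_zero]
    refine Asymptotics.IsLittleO.of_bound fun c hc => ?_
    filter_upwards [Metric.ball_mem_nhds (0 : ℝ) hc] with y hy
    have hy' : |y| < c := by simpa using hy
    have h1 : |min y 0| ≤ |y| := by
      rcases le_total y 0 with h | h <;> simp [h]
    simp only [Real.norm_eq_abs, abs_mul]
    exact mul_le_mul (h1.trans hy'.le) h1 (abs_nonneg _) hc.le
  · have h : HasDerivAt (fun _ : ℝ => (0 : ℝ)) (2 * min x 0) x := by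
      simpa [min_eq_right hx.le] using hasDerivAt_const x (0 : ℝ)
    refine h.congr_of_eventuallyEq ?_
    filter_upwards [eventually_gt_nhds hx] with y hy
    simp [min_eq_right hy.le]

/-- A primitive that starts non-negative and is non-negative almost everywhere on the set `J`
carrying its derivative is non-negative everywhere: its negative part has zero derivative. -/
theorem primitive_nonneg {T c : ℝ} (hT : 0 < T) (hc : 0 ≤ c) {V : ℝ → ℝ} {J : Set ℝ}
    (hV : IntervalIntegrable V volume 0 T) (hVJ : ∀ s ∉ J, V s = 0)
    (hpos : ∀ᵐ s, s ∈ Set.Ioo 0 T → s ∈ J → 0 ≤ c + ∫ z in 0..s, V z) :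
    ∀ s ∈ Set.Icc 0 T, 0 ≤ c + ∫ z in 0..s, V z := by
  set A : ℝ → ℝ := fun s => c + ∫ z in 0..s, V z with hA
  have hAac : AbsolutelyContinuousOnInterval A 0 T :=
    (LipschitzOnWith.absolutelyContinuousOnInterval
      ((LipschitzWith.const c).lipschitzOnWith)).add
      (hV.absolutelyContinuousOnInterval_intervalIntegral (by simp))
  have hmin : AbsolutelyContinuousOnInterval (fun x => min (A x) 0) 0 T :=
    hAac.lipschitzOnWith_comp (F := fun y => min y 0)
      (LipschitzWith.id.min_const 0).lipschitzOnWith (Set.mapsTo_univ _ _)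
  have hsq := hmin.fun_mul hmin
  have hne0 : ∀ᵐ s : ℝ, s ≠ 0 := by simp [ae_iff, measure_singleton]
  have hneT : ∀ᵐ s : ℝ, s ≠ T := by simp [ae_iff, measure_singleton]
  obtain ⟨C, hC⟩ := hsq.const_of_ae_hasDerivAt_zero <| by
    filter_upwards [hV.ae_hasDerivAt_integral, hpos, hne0, hneT] with s h1 h2 h3 h4 hs
    rw [Set.uIcc_of_le hT.le] at h1 hs
    have hd : HasDerivAt A (V s) s := (h1 hs 0 ⟨le_rfl, hT.le⟩).const_add c
    refine ((hasDerivAt_min_zero_sq (A s)).comp s hd).congr_deriv ?_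
    by_cases hJ : s ∈ J
    · have h5 : min (A s) 0 = 0 :=
        min_eq_right (h2 ⟨lt_of_le_of_ne hs.1 (Ne.symm h3), lt_of_le_of_ne hs.2 h4⟩ hJ)
      simp [h5]
    · simp [hVJ s hJ]
  rw [Set.uIcc_of_le hT.le] at hC
  intro s hs
  have h0 := hC 0 ⟨le_rfl, hT.le⟩
  have hs' := hC s hs
  have hA0 : A 0 = c := by simp [hA]
  rw [hA0, min_eq_right hc] at h0
  have : min (A s) 0 = 0 := by
    rw [← h0] at hs'
    simpa using hs'
  exact min_eq_right_iff.1 this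

/-- Entropy balance on a characteristic line: for two primitives `A, B ≥ 0` with the same initial
value, the relative entropy of the shifted values `B + δ`, `A + δ`, tested with the rate of decay of
a weight `φ` vanishing at the final time, is controlled by its rate of change. -/
theorem integral_relEntropy_le {T c δ : ℝ} (hT : 0 < T) (hδ : 0 < δ) {V W : ℝ → ℝ}
    (hV : IntervalIntegrable V volume 0 T) (hW : IntervalIntegrable W volume 0 T) {A B : ℝ → ℝ}
    (hAdef : ∀ s, A s = c + ∫ z in 0..s, V z) (hBdef : ∀ s, B s = c + ∫ z in 0..s, W z)
    (hA : ∀ s ∈ Set.Icc 0 T, 0 ≤ A s) (hB : ∀ s ∈ Set.Icc 0 T, 0 ≤ B s) {φ η : ℝ → ℝ}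
    (hφ : ContDiff ℝ 1 φ) (hη : Continuous η) (hφη : ∀ s ∈ Set.Icc 0 T, deriv φ s ≤ - η s)
    (hφT : φ T = 0) :
    ∫ s in 0..T, relEntropy (B s + δ) (A s + δ) * η s ≤
      ∫ s in 0..T, ((Real.log (B s + δ) - Real.log (A s + δ)) * W s +
        (1 - (B s + δ) / (A s + δ)) * V s) * φ s := by
  have hac : ∀ {U : ℝ → ℝ} {D : ℝ → ℝ}, IntervalIntegrable U volume 0 T →
      (∀ s, D s = c + ∫ z in 0..s, U z) → AbsolutelyContinuousOnInterval (fun s => D s + δ) 0 T := by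
    intro U D hU hD
    have h : (fun s => D s + δ) = (fun _ => c + δ) + fun s => ∫ z in 0..s, U z := by
      funext s; simp [hD]; ring
    rw [h]
    exact (LipschitzOnWith.absolutelyContinuousOnInterval
      ((LipschitzWith.const (c + δ)).lipschitzOnWith)).add
      (hU.absolutelyContinuousOnInterval_intervalIntegral (by simp))
  have hlogLip : LipschitzOnWith (Real.toNNReal δ⁻¹) Real.log (Set.Ici δ) := by
    refine Convex.lipschitzOnWith_of_nnnorm_deriv_le (fun x hx => ?_) (fun x hx => ?_)
      (convex_Ici δ)
    · exact Real.differentiableAt_log (hδ.trans_le hx).ne'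
    · rw [Real.deriv_log, ← NNReal.coe_le_coe]
      rw [Real.coe_toNNReal _ (by positivity)]
      simp only [coe_nnnorm, norm_inv, Real.norm_eq_abs, abs_of_pos (hδ.trans_le hx)]
      exact inv_anti₀ hδ hx
  have hAac := hac hV hAdef
  have hBac := hac hW hBdef
  have hAδ : Set.MapsTo (fun s => A s + δ) (Set.uIcc 0 T) (Set.Ici δ) := by
    intro s hs
    rw [Set.uIcc_of_le hT.le] at hs
    simpa using hA s hs
  have hBδ : Set.MapsTo (fun s => B s + δ) (Set.uIcc 0 T) (Set.Ici δ) := by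
    intro s hs
    rw [Set.uIcc_of_le hT.le] at hs
    simpa using hB s hs
  have hKac : AbsolutelyContinuousOnInterval
      (fun s => relEntropy (B s + δ) (A s + δ)) 0 T :=
    ((hBac.fun_mul ((hBac.lipschitzOnWith_comp hlogLip hBδ).sub
      (hAac.lipschitzOnWith_comp hlogLip hAδ))).sub hBac).add hAac
  have hφac : AbsolutelyContinuousOnInterval φ 0 T :=
    ContDiffOn.absolutelyContinuousOnInterval hφ.contDiffOn
  have key := hKac.integral_deriv_mul_eq_sub hφac
  have hA0 : A 0 = c := by simp [hAdef]
  have hB0 : B 0 = c := by simp [hBdef]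
  rw [hφT, hA0, hB0, relEntropy_self] at key
  have hKd : ∀ᵐ s, s ∈ Set.uIcc 0 T → deriv (fun s => relEntropy (B s + δ) (A s + δ)) s =
      (Real.log (B s + δ) - Real.log (A s + δ)) * W s + (1 - (B s + δ) / (A s + δ)) * V s := by
    filter_upwards [hV.ae_hasDerivAt_integral, hW.ae_hasDerivAt_integral] with s h1 h2 hs
    have hda : HasDerivAt (fun s => A s + δ) (V s) s := by
      simp only [hAdef]
      exact ((h1 hs 0 (by simp)).const_add c).add_const δ
    have hdb : HasDerivAt (fun s => B s + δ) (W s) s := by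
      simp only [hBdef]
      exact ((h2 hs 0 (by simp)).const_add c).add_const δ
    have ha : 0 < A s + δ := hδ.trans_le (hAδ hs)
    have hb : 0 < B s + δ := hδ.trans_le (hBδ hs)
    have := ((hdb.mul ((hdb.log hb.ne').sub (hda.log ha.ne'))).sub hdb).add hda
    have h3 := this.deriv
    refine Eq.trans ?_ (h3.trans ?_)
    · rfl
    · simp only [Pi.sub_apply]
      field_simp
      ring
  have hφd : Continuous (deriv φ) := hφ.continuous_deriv le_rfl
  have hi1 : IntervalIntegrable
      (fun s => deriv (fun s => relEntropy (B s + δ) (A s + δ)) s * φ s) volume 0 T :=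
    hKac.intervalIntegrable_deriv.mul_continuousOn hφ.continuous.continuousOn
  have hi2 : IntervalIntegrable
      (fun s => relEntropy (B s + δ) (A s + δ) * deriv φ s) volume 0 T :=
    (hKac.continuousOn.mul hφd.continuousOn).intervalIntegrable
  have hi3 : IntervalIntegrable
      (fun s => relEntropy (B s + δ) (A s + δ) * η s) volume 0 T :=
    (hKac.continuousOn.mul hη.continuousOn).intervalIntegrable
  rw [intervalIntegral.integral_add hi1 hi2] at key
  have hG : ∫ s in 0..T, deriv (fun s => relEntropy (B s + δ) (A s + δ)) s * φ s =
      ∫ s in 0..T, ((Real.log (B s + δ) - Real.log (A s + δ)) * W s +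
        (1 - (B s + δ) / (A s + δ)) * V s) * φ s := by
    refine intervalIntegral.integral_congr_ae ?_
    filter_upwards [hKd] with s hs hs'
    rw [hs (Set.uIoc_subset_uIcc hs')]
  have hle : ∫ s in 0..T, relEntropy (B s + δ) (A s + δ) * η s ≤
      ∫ s in 0..T, -(relEntropy (B s + δ) (A s + δ) * deriv φ s) := by
    refine intervalIntegral.integral_mono_on hT.le hi3 hi2.neg fun s hs => ?_
    have hK : 0 ≤ relEntropy (B s + δ) (A s + δ) := by
      rw [← Set.uIcc_of_le hT.le] at hs
      exact relEntropy_nonneg (hδ.trans_le (hAδ hs)) (hδ.trans_le (hBδ hs))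
    rw [← mul_neg]
    exact mul_le_mul_of_nonneg_left (by linarith [hφη s hs]) hK
  rw [intervalIntegral.integral_neg] at hle
  rw [← hG]
  linarith

/-! ### Angular averages of the entropy production -/

section Angular

variable {S : Type*} [MeasurableSpace S] {μ : Measure S} [IsFiniteMeasure μ]

theorem integrable_of_measurable_of_abs_le {h : S → ℝ} (hm : Measurable h) {C : ℝ}
    (hC : ∀ k, |h k| ≤ C) : Integrable h μ :=
  Integrable.of_bound hm.aestronglyMeasurable C (Filter.Eventually.of_forall hC)

theorem abs_log_le_of_mem_Icc {δ M x : ℝ} (hδ : 0 < δ) (h1 : δ ≤ x) (h2 : x ≤ M) :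
    |Real.log x| ≤ |Real.log δ| + |Real.log M| := by
  have h3 := Real.log_le_log hδ h1
  have h4 := Real.log_le_log (hδ.trans_le h1) h2
  rw [abs_le]
  constructor
  · linarith [neg_abs_le (Real.log δ), abs_nonneg (Real.log M)]
  · linarith [le_abs_self (Real.log M), abs_nonneg (Real.log δ)]

theorem abs_relEntropy_le {δ M a b : ℝ} (hδ : 0 < δ) (ha : δ ≤ a) (hb : δ ≤ b) (haM : a ≤ M)
    (hbM : b ≤ M) : |relEntropy b a| ≤
      M * (|Real.log δ| + |Real.log M| + (|Real.log δ| + |Real.log M|)) + M + M := by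
  unfold relEntropy
  have ha0 : 0 < a := hδ.trans_le ha
  have hb0 : 0 < b := hδ.trans_le hb
  refine (abs_add_le _ _).trans (add_le_add ((abs_sub _ _).trans (add_le_add ?_ ?_)) ?_)
  · rw [abs_mul]
    exact mul_le_mul (by rwa [abs_of_pos hb0]) ((abs_sub _ _).trans (add_le_add
      (abs_log_le_of_mem_Icc hδ hb hbM) (abs_log_le_of_mem_Icc hδ ha haM))) (abs_nonneg _)
      (by linarith)
  · rwa [abs_of_pos hb0]
  · rwa [abs_of_pos ha0]

/-- A symmetric collision kernel with unit mass dissipates the relative entropy of any two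
distributions. -/
theorem integral_collision_le_zero {q : S → S → ℝ} (hq : Measurable (Function.uncurry q)) {C : ℝ}
    (hq0 : ∀ k k', 0 ≤ q k k') (hqC : ∀ k k', q k k' ≤ C) (hsymm : ∀ k k', q k k' = q k' k)
    (hq1 : ∀ k, ∫ k', q k k' ∂μ = 1) {α β : S → ℝ} (hα : Measurable α) (hβ : Measurable β)
    {δ M : ℝ} (hδ : 0 < δ) (hαδ : ∀ k, δ ≤ α k) (hβδ : ∀ k, δ ≤ β k) (hαM : ∀ k, α k ≤ M)
    (hβM : ∀ k, β k ≤ M) :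
    Integrable (fun k => (Real.log (β k) - Real.log (α k)) * (∫ k', q k k' * β k' ∂μ - β k) +
      (1 - β k / α k) * (∫ k', q k k' * α k' ∂μ - α k)) μ ∧
    ∫ k, ((Real.log (β k) - Real.log (α k)) * (∫ k', q k k' * β k' ∂μ - β k) +
      (1 - β k / α k) * (∫ k', q k k' * α k' ∂μ - α k)) ∂μ ≤ 0 := by
  have hα0 : ∀ k, 0 < α k := fun k => hδ.trans_le (hαδ k)
  have hβ0 : ∀ k, 0 < β k := fun k => hδ.trans_le (hβδ k)
  have hqk : ∀ k, Measurable (q k) := fun k => hq.comp measurable_prodMk_left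
  have hqabs : ∀ k k', |q k k'| ≤ C := fun k k' => by
    rw [abs_of_nonneg (hq0 k k')]; exact hqC k k'
  set H : S → ℝ := fun k => relEntropy (β k) (α k) with hH
  have hHm : Measurable H := by
    simp only [hH, relEntropy]; fun_prop
  set l := |Real.log δ| + |Real.log M|
  have hll : ∀ k, |Real.log (β k) - Real.log (α k)| ≤ l + l := fun k =>
    (abs_sub _ _).trans (add_le_add (abs_log_le_of_mem_Icc hδ (hβδ k) (hβM k))
      (abs_log_le_of_mem_Icc hδ (hαδ k) (hαM k)))
  have hHb : ∀ k, |H k| ≤ M * (l + l) + M + M := fun k =>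
    abs_relEntropy_le hδ (hαδ k) (hβδ k) (hαM k) (hβM k)
  -- integrability of the kernel against a bounded function
  have hint : ∀ {g : S → ℝ}, Measurable g → ∀ {D : ℝ}, (∀ k, |g k| ≤ D) → ∀ k,
      Integrable (fun k' => q k k' * g k') μ := fun hg D hD k =>
    integrable_of_measurable_of_abs_le ((hqk k).mul hg) (C := C * D) fun k' => by
      rw [abs_mul]
      exact mul_le_mul (hqabs k k') (hD k') (abs_nonneg _) ((abs_nonneg _).trans (hqabs k k'))
  have hintm : ∀ {g : S → ℝ}, Measurable g → ∀ {D : ℝ}, (∀ k, |g k| ≤ D) →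
      Integrable (fun k => ∫ k', q k k' * g k' ∂μ) μ := fun {g} hg D hD => by
    have : Integrable (fun z : S × S => q z.1 z.2 * g z.2) (μ.prod μ) :=
      integrable_of_measurable_of_abs_le (hq.mul (hg.comp measurable_snd)) (C := C * D) fun z => by
        rw [abs_mul]
        exact mul_le_mul (hqabs _ _) (hD _) (abs_nonneg _) ((abs_nonneg _).trans (hqabs z.1 z.2))
    exact this.integral_prod_left
  have hαabs : ∀ k, |α k| ≤ M := fun k => by rw [abs_of_pos (hα0 k)]; exact hαM k
  have hβabs : ∀ k, |β k| ≤ M := fun k => by rw [abs_of_pos (hβ0 k)]; exact hβM k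
  have hquot : ∀ k, |1 - β k / α k| ≤ 1 + M / δ := fun k => by
    refine (abs_sub _ _).trans (add_le_add (by simp) ?_)
    rw [abs_of_pos (div_pos (hβ0 k) (hα0 k))]
    exact div_le_div₀ ((hβ0 k).le.trans (hβM k)) (hβM k) hδ (hαδ k)
  have hI : Integrable (fun k => (Real.log (β k) - Real.log (α k)) *
      (∫ k', q k k' * β k' ∂μ - β k) +
      (1 - β k / α k) * (∫ k', q k k' * α k' ∂μ - α k)) μ := by
    refine Integrable.add ?_ ?_
    · exact ((hintm hβ hβabs).sub (integrable_of_measurable_of_abs_le hβ hβabs)).bdd_mul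
        (c := l + l) (by fun_prop) (Filter.Eventually.of_forall hll)
    · exact ((hintm hα hαabs).sub (integrable_of_measurable_of_abs_le hα hαabs)).bdd_mul
        (c := 1 + M / δ) (measurable_const.sub (hβ.div hα)).aestronglyMeasurable (Filter.Eventually.of_forall hquot)
  refine ⟨hI, ?_⟩
  have hqi : ∀ k, Integrable (q k) μ := fun k =>
    integrable_of_measurable_of_abs_le (hqk k) (hqabs k)
  -- the unit mass of the kernel turns `K g - g` into an average of differences
  have hdiff : ∀ {g : S → ℝ}, Measurable g → ∀ {D : ℝ}, (∀ k, |g k| ≤ D) → ∀ k,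
      ∫ k', q k k' * g k' ∂μ - g k = ∫ k', q k k' * (g k' - g k) ∂μ := fun {g} hg D hD k => by
    simp only [mul_sub]
    rw [integral_sub (hint hg hD k) ((hqi k).mul_const _), integral_mul_const, hq1, one_mul]
  have hdiffi : ∀ {g : S → ℝ}, Measurable g → ∀ {D : ℝ}, (∀ k, |g k| ≤ D) → ∀ k,
      Integrable (fun k' => q k k' * (g k' - g k)) μ := fun {g} hg D hD k => by
    simp only [mul_sub]
    exact (hint hg hD k).sub ((hqi k).mul_const _)
  have hpt : ∀ k, (Real.log (β k) - Real.log (α k)) * (∫ k', q k k' * β k' ∂μ - β k) +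
      (1 - β k / α k) * (∫ k', q k k' * α k' ∂μ - α k) ≤ ∫ k', q k k' * H k' ∂μ - H k := by
    intro k
    rw [hdiff hβ hβabs, hdiff hα hαabs, hdiff hHm hHb, ← integral_const_mul, ← integral_const_mul,
      ← integral_add ((hdiffi hβ hβabs k).const_mul _) ((hdiffi hα hαabs k).const_mul _)]
    refine integral_mono (((hdiffi hβ hβabs k).const_mul _).add ((hdiffi hα hαabs k).const_mul _))
      (hdiffi hHm hHb k) fun k' => ?_
    have := mul_le_mul_of_nonneg_left
      (collision_le_relEntropy_sub (hα0 k) (hβ0 k) (hα0 k') (hβ0 k')) (hq0 k k')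
    simp only [hH]
    linarith
  have hHi : Integrable H μ := integrable_of_measurable_of_abs_le hHm hHb
  have hswap : ∫ k, ∫ k', q k k' * H k' ∂μ ∂μ = ∫ k, H k ∂μ := by
    rw [integral_integral_swap]
    · refine integral_congr_ae (Filter.Eventually.of_forall fun k' => ?_)
      simp only [integral_mul_const]
      simp only [fun k => hsymm k k', hq1, one_mul]
    · refine integrable_of_measurable_of_abs_le (hq.mul (hHm.comp measurable_snd))
        (C := C * (M * (l + l) + M + M)) fun z => ?_
      change |q z.1 z.2 * H z.2| ≤ _
      rw [abs_mul]
      exact mul_le_mul (hqabs _ _) (hHb _) (abs_nonneg _) ((abs_nonneg _).trans (hqabs z.1 z.2))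
  calc _ ≤ ∫ k, (∫ k', q k k' * H k' ∂μ - H k) ∂μ :=
        integral_mono hI ((hintm hHm hHb).sub hHi) hpt
    _ = 0 := by rw [integral_sub (hintm hHm hHb) hHi, hswap, sub_self]

/-- At a fixed position, the total entropy production of two solutions `u, w` of the transport
equation with the same angular average is of the order of the regularisation `δ log (1 / δ)`:
scattering dissipates entropy, absorption contributes a non-positive term together with a multiple
of the difference of the averages, and the regularisation produces the remaining error. -/
theorem integral_entropyProduction_le {q : S → S → ℝ} (hq : Measurable (Function.uncurry q)) {C : ℝ}
    (hq0 : ∀ k k', 0 ≤ q k k') (hqC : ∀ k k', q k k' ≤ C) (hsymm : ∀ k k', q k k' = q k' k)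
    (hq1 : ∀ k, ∫ k', q k k' ∂μ = 1) {u w v v' : S → ℝ} (hu : Measurable u) (hw : Measurable w)
    {δ M a b Ss : ℝ} (hδ : 0 < δ) (hSs : 0 ≤ Ss) (ha : 0 ≤ a) (hb : 0 ≤ b)
    (hu0 : ∀ k, 0 < u k) (hw0 : ∀ k, 0 < w k) (huM : ∀ k, u k ≤ M) (hwM : ∀ k, w k ≤ M)
    (hmean : ∫ k, u k ∂μ = ∫ k, w k ∂μ)
    (heq : ∀ᵐ k ∂μ, v k + a * u k + Ss * (u k - ∫ k', q k k' * u k' ∂μ) = 0)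
    (heq' : ∀ᵐ k ∂μ, v' k + b * w k + Ss * (w k - ∫ k', q k k' * w k' ∂μ) = 0)
    (hleft : Integrable (fun k => (Real.log (w k + δ) - Real.log (u k + δ)) * v' k +
        (1 - (w k + δ) / (u k + δ)) * v k) μ) :
    ∫ k, ((Real.log (w k + δ) - Real.log (u k + δ)) * v' k +
        (1 - (w k + δ) / (u k + δ)) * v k) ∂μ ≤
      δ * (b * (Real.log (M + δ) - Real.log δ) + a) * μ.real Set.univ := by
  obtain ⟨hcI, hc⟩ := integral_collision_le_zero (μ := μ) hq hq0 hqC hsymm hq1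
    (hu.add_const δ) (hw.add_const δ) (M := M + δ) hδ (fun k => by linarith [hu0 k])
    (fun k => by linarith [hw0 k]) (fun k => by linarith [huM k]) (fun k => by linarith [hwM k])
  set coll := fun k => (Real.log (w k + δ) - Real.log (u k + δ)) *
      (∫ k', q k k' * (w k' + δ) ∂μ - (w k + δ)) +
      (1 - (w k + δ) / (u k + δ)) * (∫ k', q k k' * (u k' + δ) ∂μ - (u k + δ)) with hcoll
  have hqi : ∀ k, Integrable (q k) μ := fun k =>
    integrable_of_measurable_of_abs_le (hq.comp measurable_prodMk_left) (C := C) fun k' => by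
      rw [abs_of_nonneg (hq0 k k')]; exact hqC k k'
  have habs : ∀ {g : S → ℝ}, (∀ k, 0 < g k) → (∀ k, g k ≤ M) → ∀ k, ‖g k‖ ≤ M :=
    fun h0 hM k => by rw [Real.norm_eq_abs, abs_of_pos (h0 k)]; exact hM k
  have hshift : ∀ {g : S → ℝ}, Measurable g → (∀ k, 0 < g k) → (∀ k, g k ≤ M) → ∀ k,
      ∫ k', q k k' * (g k' + δ) ∂μ = ∫ k', q k k' * g k' ∂μ + δ := fun {g} hg h0 hM k => by
    simp only [mul_add]
    rw [integral_add ((hqi k).mul_bdd (c := M) hg.aestronglyMeasurable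
      (Filter.Eventually.of_forall (habs h0 hM))) ((hqi k).mul_const _), integral_mul_const, hq1,
      one_mul]
  have hui : Integrable u μ := integrable_of_measurable_of_abs_le hu (habs hu0 huM)
  have hwi : Integrable w μ := integrable_of_measurable_of_abs_le hw (habs hw0 hwM)
  set e := δ * (b * (Real.log (M + δ) - Real.log δ) + a) with he
  have hpt : ∀ᵐ k ∂μ, (Real.log (w k + δ) - Real.log (u k + δ)) * v' k +
        (1 - (w k + δ) / (u k + δ)) * v k ≤ Ss * coll k + (b - a) * (u k - w k) + e := by
    filter_upwards [heq, heq'] with k h1 h2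
    have hα : 0 < u k + δ := by linarith [hu0 k]
    have hβ : 0 < w k + δ := by linarith [hw0 k]
    have hv : v k = -(a * u k) - Ss * (u k - ∫ k', q k k' * u k' ∂μ) := by linarith
    have hv' : v' k = -(b * w k) - Ss * (w k - ∫ k', q k k' * w k' ∂μ) := by linarith
    have hl : Real.log (w k + δ) - Real.log (u k + δ) ≤ Real.log (M + δ) - Real.log δ :=
      sub_le_sub (Real.log_le_log hβ (by linarith [hwM k]))
        (Real.log_le_log hδ (by linarith [hu0 k]))
    have hH := relEntropy_nonneg hα hβ
    have hquot : (w k + δ) / (u k + δ) * (u k + δ) = w k + δ := by field_simp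
    have hquot0 : 0 ≤ (w k + δ) / (u k + δ) := by positivity
    rw [hv, hv', hcoll, he]
    simp only [hshift hu hu0 huM, hshift hw hw0 hwM]
    set l := Real.log (w k + δ) - Real.log (u k + δ)
    set r := (w k + δ) / (u k + δ)
    have hH' : 0 ≤ b * ((w k + δ) * l - (w k + δ) + (u k + δ)) := mul_nonneg hb hH
    have h3 : δ * (b * l) ≤ δ * (b * (Real.log (M + δ) - Real.log δ)) := by gcongr
    have h4 : 0 ≤ δ * (a * r) := by positivity
    have h5 : a * (r * u k + r * δ - w k - δ) = 0 := by
      rw [show r * u k + r * δ - w k - δ = r * (u k + δ) - (w k + δ) by ring, hquot, sub_self,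
        mul_zero]
    linarith
  have hright : Integrable (fun k => Ss * coll k + (b - a) * (u k - w k) + e) μ :=
    ((hcI.const_mul Ss).add ((hui.sub hwi).const_mul _)).add (integrable_const e)
  have hval : ∫ k, (Ss * coll k + (b - a) * (u k - w k) + e) ∂μ =
      Ss * ∫ k, coll k ∂μ + e * μ.real Set.univ := by
    have h1 : Integrable (fun k => Ss * coll k) μ := hcI.const_mul Ss
    have h2 : Integrable (fun k => (b - a) * (u k - w k)) μ := (hui.sub hwi).const_mul _
    have h12 : Integrable (fun k => Ss * coll k + (b - a) * (u k - w k)) μ := h1.add h2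
    rw [integral_add h12 (integrable_const e), integral_add h1 h2, integral_const_mul,
      integral_const_mul, integral_sub hui hwi, hmean, integral_const, smul_eq_mul]
    ring
  have hfin : Ss * ∫ k, coll k ∂μ ≤ 0 := mul_nonpos_of_nonneg_of_nonpos hSs hc
  calc _ ≤ ∫ k, (Ss * coll k + (b - a) * (u k - w k) + e) ∂μ := integral_mono_ae hleft hright hpt
    _ ≤ _ := by rw [hval]; linarith

end Angular

/-! ### Phase space in characteristic coordinates -/

section Characteristics

variable {d : ℕ}

instance : IsFiniteMeasure (dirMeasure d) := by
  unfold dirMeasure; infer_instance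

/-- Lebesgue measure times surface measure on the whole of `ℝ × ℝ^d × S^{d-1}`. -/
noncomputable def lineMeasure (d : ℕ) : Measure (ℝ × Space d × Dir d) :=
  (volume : Measure ℝ).prod ((volume : Measure (Space d)).prod (dirMeasure d))

instance : SFinite (lineMeasure d) := by
  unfold lineMeasure; infer_instance

/-- The phase space `X = (0,T) × Ω × S^{d-1}`. -/
def phaseSet (Ω : Set (Space d)) (T : ℝ) : Set (ℝ × Space d × Dir d) :=
  Set.Ioo 0 T ×ˢ Ω ×ˢ Set.univ

/-- The map from characteristic coordinates `(z, ξ, k)`, in which characteristic lines are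
`{ξ, k fixed}`, to physical coordinates `(z, ξ + z k, k)`. -/
def shear (y : ℝ × Space d × Dir d) : ℝ × Space d × Dir d :=
  (y.1, y.2.1 + y.1 • (y.2.2 : Space d), y.2.2)

/-- The extension by zero of a function on `X`, in characteristic coordinates. -/
noncomputable def alongLines (Ω : Set (Space d)) (T : ℝ) (F : ℝ × Space d × Dir d → ℝ) :
    ℝ × Space d × Dir d → ℝ :=
  fun y => (phaseSet Ω T).indicator F (shear y)

/-- The inclusion of `ℝ × ℝ^d × S^{d-1}` in the ambient space `ℝ × ℝ^d × ℝ^d`. -/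
def ambient (y : ℝ × Space d × Dir d) : ℝ × Space d × Space d := (y.1, y.2.1, (y.2.2 : Space d))

theorem phaseMeasure_eq_restrict (Ω : Set (Space d)) (T : ℝ) :
    phaseMeasure Ω T = (lineMeasure d).restrict (phaseSet Ω T) := by
  rw [phaseMeasure, initialMeasure, lineMeasure, phaseSet, ← Measure.prod_restrict,
    ← Measure.prod_restrict, Measure.restrict_univ]

theorem initialMeasure_eq_restrict (Ω : Set (Space d)) :
    initialMeasure Ω =
      ((volume : Measure (Space d)).prod (dirMeasure d)).restrict (Ω ×ˢ Set.univ) := by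
  rw [initialMeasure, ← Measure.prod_restrict, Measure.restrict_univ]

theorem measurableSet_phaseSet {Ω : Set (Space d)} (hΩ : IsOpen Ω) (T : ℝ) :
    MeasurableSet (phaseSet Ω T) :=
  measurableSet_Ioo.prod (hΩ.measurableSet.prod MeasurableSet.univ)

theorem measurable_shear : Measurable (shear (d := d)) := by
  unfold shear; fun_prop

theorem measurableEmbedding_ambient : MeasurableEmbedding (ambient (d := d)) :=
  MeasurableEmbedding.id.prodMap (MeasurableEmbedding.id.prodMap
    (MeasurableEmbedding.subtype_coe Metric.isClosed_sphere.measurableSet))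

theorem measurePreserving_shear : MeasurePreserving (shear (d := d)) (lineMeasure d)
    (lineMeasure d) := by
  refine (MeasurePreserving.id (volume : Measure ℝ)).skew_product
    (g := fun (z : ℝ) (w : Space d × Dir d) => (w.1 + z • (w.2 : Space d), w.2)) (by fun_prop) ?_
  refine Filter.Eventually.of_forall fun z => ?_
  have hswap : MeasurePreserving (fun w : Dir d × Space d => (w.1, w.2 + z • (w.1 : Space d)))
      ((dirMeasure d).prod volume) ((dirMeasure d).prod volume) := by
    refine (MeasurePreserving.id (dirMeasure d)).skew_product
      (g := fun k x => x + z • (k : Space d)) (by fun_prop) ?_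
    exact Filter.Eventually.of_forall fun k => map_add_right_eq_self volume _
  exact ((Measure.measurePreserving_swap.comp hswap).comp Measure.measurePreserving_swap).map_eq

theorem measurable_alongLines {Ω : Set (Space d)} (hΩ : IsOpen Ω) (T : ℝ)
    {F : ℝ × Space d × Dir d → ℝ} (hF : Measurable F) : Measurable (alongLines Ω T F) :=
  (hF.indicator (measurableSet_phaseSet hΩ T)).comp measurable_shear

theorem integral_phaseMeasure {Ω : Set (Space d)} (hΩ : IsOpen Ω) (T : ℝ)
    {F : ℝ × Space d × Dir d → ℝ} (hF : Measurable F) :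
    ∫ y, F y ∂(phaseMeasure Ω T) = ∫ y, alongLines Ω T F y ∂(lineMeasure d) := by
  rw [phaseMeasure_eq_restrict, ← integral_indicator (measurableSet_phaseSet hΩ T)]
  conv_lhs => rw [← measurePreserving_shear.map_eq]
  rw [integral_map measurable_shear.aemeasurable
    (hF.indicator (measurableSet_phaseSet hΩ T)).aestronglyMeasurable]
  rfl

theorem alongLines_of_shear_mem {Ω : Set (Space d)} {T : ℝ} {F : ℝ × Space d × Dir d → ℝ}
    {y : ℝ × Space d × Dir d} (hy : shear y ∈ phaseSet Ω T) : alongLines Ω T F y = F (shear y) :=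
  Set.indicator_of_mem hy _

theorem alongLines_of_shear_notMem {Ω : Set (Space d)} {T : ℝ} {F : ℝ × Space d × Dir d → ℝ}
    {y : ℝ × Space d × Dir d} (hy : shear y ∉ phaseSet Ω T) : alongLines Ω T F y = 0 :=
  Set.indicator_of_notMem hy _

theorem alongLines_of_notMem {Ω : Set (Space d)} {T : ℝ} {F : ℝ × Space d × Dir d → ℝ}
    {y : ℝ × Space d × Dir d} (hy : y.1 ∉ Set.Ioo 0 T) : alongLines Ω T F y = 0 :=
  alongLines_of_shear_notMem fun h => hy h.1

theorem abs_alongLines_le {Ω : Set (Space d)} {T : ℝ} {F : ℝ × Space d × Dir d → ℝ} {M : ℝ}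
    (hF : ∀ y, |F y| ≤ M) (y : ℝ × Space d × Dir d) : |alongLines Ω T F y| ≤ M := by
  classical
  unfold alongLines
  rw [Set.indicator_apply]
  split_ifs
  · exact hF _
  · simpa using (abs_nonneg _).trans (hF y)

theorem integrable_lineMeasure_of_bounded {h : ℝ × Space d × Dir d → ℝ} (hm : Measurable h)
    {C R : ℝ} (hC : ∀ y, |h y| ≤ C) (hR : ∀ y, h y ≠ 0 → |y.1| ≤ R ∧ ‖y.2.1‖ ≤ R) :
    Integrable h (lineMeasure d) := by
  set K : Set (ℝ × Space d × Dir d) :=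
    Metric.closedBall (0 : ℝ) R ×ˢ Metric.closedBall (0 : Space d) R ×ˢ Set.univ with hK
  have hKm : MeasurableSet K :=
    measurableSet_closedBall.prod (measurableSet_closedBall.prod MeasurableSet.univ)
  have hKfin : lineMeasure d K < ⊤ := by
    rw [hK, lineMeasure, Measure.prod_prod, Measure.prod_prod]
    exact ENNReal.mul_lt_top measure_closedBall_lt_top
      (ENNReal.mul_lt_top measure_closedBall_lt_top (measure_lt_top _ _))
  have hi : IntegrableOn h K (lineMeasure d) :=
    Measure.integrableOn_of_bounded (M := C) hKfin.ne hm.aestronglyMeasurable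
      (Filter.Eventually.of_forall hC)
  refine (integrableOn_iff_integrable_of_support_subset fun y hy => ?_).1 hi
  obtain ⟨h1, h2⟩ := hR y hy
  exact ⟨by simpa using h1, by simpa using h2, Set.mem_univ _⟩

/-! ### Test functions that are constant along characteristics up to a given source -/

/-- The integral of `g` over the part of the characteristic line through `(z, ξ, k)` that lies
ahead of it, in characteristic coordinates. -/
noncomputable def forwardIntegral (g : ℝ × Space d × Space d → ℝ) (y : ℝ × Space d × Space d) : ℝ :=
  ∫ s, if y.1 < s then g (s, y.2) else 0

theorem contDiff_forwardIntegral {g : ℝ × Space d × Space d → ℝ}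
    (hg : ContDiff ℝ ((⊤ : ℕ∞) : WithTop ℕ∞) g) (hc : HasCompactSupport g) :
    ContDiff ℝ ((⊤ : ℕ∞) : WithTop ℕ∞) (forwardIntegral g) := by
  have h := contDiffOn_convolution_right_with_param (𝕜 := ℝ) (μ := (volume : Measure ℝ))
    (f := (Set.Iio (0 : ℝ)).indicator fun _ => (1 : ℝ)) (n := (⊤ : ℕ∞))
    (ContinuousLinearMap.mul ℝ ℝ) (g := fun (w : Space d × Space d) s => g (s, w))
    (s := Set.univ) (k := Prod.fst '' tsupport g) isOpen_univ
    (hc.isCompact.image continuous_fst)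
    (fun w s _ hs => by
      by_contra hne
      exact hs ⟨(s, w), subset_tsupport _ hne, rfl⟩)
    ((locallyIntegrable_const (1 : ℝ)).indicator measurableSet_Iio)
    (by
      refine ContDiff.contDiffOn ?_
      exact hg.comp (contDiff_snd.prodMk contDiff_fst))
  rw [Set.univ_prod_univ, contDiffOn_univ] at h
  have h2 := h.comp (contDiff_snd.prodMk contDiff_fst :
    ContDiff ℝ ((⊤ : ℕ∞) : WithTop ℕ∞) fun y : ℝ × Space d × Space d => (y.2, y.1))
  convert! h2 using 1
  funext y
  simp only [forwardIntegral, Function.comp, convolution, ContinuousLinearMap.mul_apply']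
  rw [← integral_sub_left_eq_self _ volume y.1]
  refine integral_congr_ae (Filter.Eventually.of_forall fun t => ?_)
  by_cases ht : t < 0
  · simp [ht]
  · simp [ht, show ¬ y.1 < y.1 - t by linarith]

theorem exists_of_forwardIntegral_ne_zero {g : ℝ × Space d × Space d → ℝ}
    {y : ℝ × Space d × Space d} (h : forwardIntegral g y ≠ 0) : ∃ s, y.1 < s ∧ g (s, y.2) ≠ 0 := by
  by_contra! hn
  refine h ?_
  refine integral_eq_zero_of_ae (Filter.Eventually.of_forall fun s => ?_)
  by_cases hs : y.1 < s
  · simp [hs, hn s hs]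
  · simp [hs]

theorem hasDerivAt_forwardIntegral {g : ℝ × Space d × Space d → ℝ} (hg : Continuous g)
    (hc : HasCompactSupport g) (z : ℝ) (w : Space d × Space d) :
    HasDerivAt (fun z => forwardIntegral g (z, w)) (-g (z, w)) z := by
  have hgw : Continuous fun s => g (s, w) := by fun_prop
  have hi : Integrable fun s => g (s, w) := by
    refine hgw.integrable_of_hasCompactSupport ?_
    refine HasCompactSupport.of_support_subset_isCompact (hc.isCompact.image continuous_fst) ?_
    exact fun s hs => ⟨(s, w), subset_tsupport _ hs, rfl⟩
  have hform : (fun z => forwardIntegral g (z, w)) =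
      fun z => (∫ s in Set.Ioi 0, g (s, w)) - ∫ s in (0 : ℝ)..z, g (s, w) := by
    funext z
    rw [← intervalIntegral.integral_interval_add_Ioi (a := 0) (b := z) hi.integrableOn
      hi.integrableOn]
    have : forwardIntegral g (z, w) = ∫ s in Set.Ioi z, g (s, w) := by
      rw [← integral_indicator measurableSet_Ioi]
      rfl
    rw [this]; ring
  rw [hform]
  exact (intervalIntegral.integral_hasDerivAt_right (hgw.intervalIntegrable _ _)
    (hgw.stronglyMeasurableAtFilter _ _) hgw.continuousAt).const_sub _

/-- The test function, in physical coordinates, whose transport derivative is `-g` in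
characteristic coordinates for `z > 0`; the cut-off only acts at negative `z`. -/
noncomputable def lineTestFunction (g : ℝ × Space d × Space d → ℝ)
    (y : ℝ × Space d × Space d) : ℝ :=
  Real.smoothTransition (y.1 + 2) * forwardIntegral g (y.1, y.2.1 - y.1 • y.2.2, y.2.2)

theorem contDiff_lineTestFunction {g : ℝ × Space d × Space d → ℝ}
    (hg : ContDiff ℝ ((⊤ : ℕ∞) : WithTop ℕ∞) g) (hc : HasCompactSupport g) :
    ContDiff ℝ ((⊤ : ℕ∞) : WithTop ℕ∞) (lineTestFunction g) := by
  refine ContDiff.mul (Real.smoothTransition.contDiff.comp (contDiff_fst.add contDiff_const)) ?_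
  refine (contDiff_forwardIntegral hg hc).comp ?_
  fun_prop

theorem transportDeriv_lineTestFunction {g : ℝ × Space d × Space d → ℝ}
    (hg : ContDiff ℝ ((⊤ : ℕ∞) : WithTop ℕ∞) g) (hc : HasCompactSupport g)
    {y : ℝ × Space d × Dir d} (hy : 0 < y.1) :
    transportDeriv (lineTestFunction g) y =
      - g (y.1, y.2.1 - y.1 • (y.2.2 : Space d), (y.2.2 : Space d)) := by
  set k : Space d := (y.2.2 : Space d) with hk
  set p : ℝ × Space d × Space d := (y.1, y.2.1, k) with hp
  have hdiff : DifferentiableAt ℝ (lineTestFunction g) p :=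
    ((contDiff_lineTestFunction hg hc).differentiable (by simp)) p
  have hline : HasDerivAt (fun τ : ℝ => p + τ • ((1, k, 0) : ℝ × Space d × Space d)) (1, k, 0) 0 := by
    simpa using ((hasDerivAt_id (0 : ℝ)).smul_const
      ((1, k, 0) : ℝ × Space d × Space d)).const_add p
  have h1 : HasDerivAt (fun τ : ℝ => lineTestFunction g (p + τ • ((1, k, 0) : ℝ × Space d × Space d)))
      (transportDeriv (lineTestFunction g) y) 0 := by
    have hd : HasFDerivAt (lineTestFunction g) (fderiv ℝ (lineTestFunction g) p)
        (p + (0 : ℝ) • ((1, k, 0) : ℝ × Space d × Space d)) := by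
      simpa using hdiff.hasFDerivAt
    exact hd.comp_hasDerivAt (0 : ℝ) hline
  have h2 : HasDerivAt (fun τ : ℝ => lineTestFunction g (p + τ • ((1, k, 0) : ℝ × Space d × Space d)))
      (-g (y.1, y.2.1 - y.1 • k, k)) 0 := by
    have h3 : HasDerivAt (fun τ : ℝ => forwardIntegral g (y.1 + τ, y.2.1 - y.1 • k, k))
        (-g (y.1, y.2.1 - y.1 • k, k)) 0 := by
      have := hasDerivAt_forwardIntegral hg.continuous hc (y.1 + 0) (y.2.1 - y.1 • k, k)
      simpa using this.comp_const_add y.1 0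
    refine h3.congr_of_eventuallyEq ?_
    filter_upwards [eventually_gt_nhds (show -y.1 < (0 : ℝ) by linarith)] with τ hτ
    have hone : Real.smoothTransition (y.1 + τ + 2) = 1 :=
      Real.smoothTransition.one_of_one_le (by linarith)
    have hx : y.2.1 + τ • k - (y.1 + τ) • k = y.2.1 - y.1 • k := by
      rw [add_smul]; abel
    simp [lineTestFunction, hp, hone, hx]
  exact h1.unique h2

/-- A source `g` carried by the characteristic coordinates of `X` produces an admissible test
function: ahead of a point of the outflow boundary a characteristic line never meets `Ω` again. -/
theorem isTestFunction_lineTestFunction {Ω : Set (Space d)} {T : ℝ}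
    {g : ℝ × Space d × Space d → ℝ} (hg : ContDiff ℝ ((⊤ : ℕ∞) : WithTop ℕ∞) g)
    (hc : HasCompactSupport g)
    (hsupp : tsupport g ⊆ {q | q.1 ∈ Set.Ioo 0 T ∧ q.2.1 + q.1 • q.2.2 ∈ Ω}) :
    IsTestFunction Ω T (lineTestFunction g) where
  smooth := contDiff_lineTestFunction hg hc
  compact_support := by
    obtain ⟨R, hR⟩ := hc.isCompact.isBounded.subset_closedBall (0 : ℝ × Space d × Space d)
    set R' := max R 2 with hR'
    refine HasCompactSupport.of_support_subset_isCompact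
      ((isCompact_closedBall (0 : ℝ) R').prod ((isCompact_closedBall (0 : Space d) (R' + R' * R')).prod
        (isCompact_closedBall (0 : Space d) R'))) fun y hy => ?_
    have hy1 : Real.smoothTransition (y.1 + 2) ≠ 0 := left_ne_zero_of_mul hy
    have hy2 := right_ne_zero_of_mul hy
    obtain ⟨s, hs, hgs⟩ := exists_of_forwardIntegral_ne_zero hy2
    have hmem := hR (subset_tsupport _ hgs)
    rw [mem_closedBall_zero_iff, norm_prod_le_iff, norm_prod_le_iff] at hmem
    obtain ⟨m1, m2, m3⟩ := hmem
    simp only at m1 m2 m3 hs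
    have hz : -2 < y.1 := by
      by_contra hcon
      exact hy1 (Real.smoothTransition.zero_of_nonpos (by linarith))
    have hRR' : R ≤ R' := le_max_left _ _
    have h2R' : 2 ≤ R' := le_max_right _ _
    have hzR : |y.1| ≤ R' := by
      rw [abs_le]
      have := (le_abs_self s).trans m1
      constructor <;> linarith
    refine ⟨by simpa using hzR, ?_, by simpa using m3.trans hRR'⟩
    rw [mem_closedBall_zero_iff]
    calc ‖y.2.1‖ = ‖(y.2.1 - y.1 • y.2.2) + y.1 • y.2.2‖ := by rw [sub_add_cancel]
      _ ≤ ‖y.2.1 - y.1 • y.2.2‖ + ‖y.1 • y.2.2‖ := norm_add_le _ _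
      _ ≤ R' + R' * R' := by
        rw [norm_smul]
        exact add_le_add (m2.trans hRR')
          (mul_le_mul hzR (m3.trans hRR') (norm_nonneg _) (by linarith))
  final := by
    intro x _ k
    by_contra hne
    obtain ⟨s, hs, hgs⟩ := exists_of_forwardIntegral_ne_zero (right_ne_zero_of_mul hne)
    have := (hsupp (subset_tsupport _ hgs)).1.2
    simp only at hs this
    linarith
  outflow := by
    intro z hz x hx k n hn hnk
    by_contra hne
    obtain ⟨s, hs, hgs⟩ := exists_of_forwardIntegral_ne_zero (right_ne_zero_of_mul hne)
    have hmem := (hsupp (subset_tsupport _ hgs)).2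
    have h := hn.2 _ hmem
    simp only at hs h
    rw [show x - z • (k : Space d) + s • (k : Space d) - x = (s - z) • (k : Space d) by
      rw [sub_smul]; abel, inner_smul_right] at h
    nlinarith [mul_pos (sub_pos.2 hs) hnk]

end Characteristics

/-! ### Weak solutions are integrals of their transport derivative along characteristics -/

section Representation

variable {d : ℕ}

/-- The integral of `V` over the part of the characteristic line through `y` that lies behind it,
in characteristic coordinates. -/
noncomputable def pastIntegral (V : ℝ × Space d × Dir d → ℝ) (y : ℝ × Space d × Dir d) : ℝ :=
  ∫ z, if z < y.1 then V (z, y.2) else 0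

theorem measurable_pastIntegral {V : ℝ × Space d × Dir d → ℝ} (hV : Measurable V) :
    Measurable (pastIntegral V) := by
  have hm : Measurable fun p : (ℝ × Space d × Dir d) × ℝ =>
      if p.2 < p.1.1 then V (p.2, p.1.2) else 0 :=
    Measurable.ite (measurableSet_lt (by fun_prop) (by fun_prop)) (by fun_prop) measurable_const
  exact (hm.stronglyMeasurable.integral_prod_right).measurable

theorem abs_integral_le_of_Ioo {h : ℝ → ℝ} {M T : ℝ} (hT : 0 ≤ T) (hM : ∀ z, |h z| ≤ M)
    (hz : ∀ z ∉ Set.Ioo 0 T, h z = 0) : |∫ z, h z| ≤ M * T := by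
  rw [← setIntegral_eq_integral_of_forall_compl_eq_zero hz]
  have := norm_setIntegral_le_of_norm_le_const (μ := volume) (s := Set.Ioo 0 T) (f := h) (C := M)
    (by simp) (fun z _ => hM z)
  simpa [hT] using this

theorem abs_pastIntegral_alongLines_le {Ω : Set (Space d)} {T : ℝ} (hT : 0 ≤ T)
    {v : ℝ × Space d × Dir d → ℝ} {M : ℝ} (hv : ∀ y, |v y| ≤ M) (y : ℝ × Space d × Dir d) :
    |pastIntegral (alongLines Ω T v) y| ≤ M * T := by
  have hM0 : 0 ≤ M := (abs_nonneg _).trans (hv y)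
  refine abs_integral_le_of_Ioo hT (fun z => ?_) fun z hz => ?_
  · split_ifs
    · exact abs_alongLines_le hv _
    · simpa using hM0
  · rw [alongLines_of_notMem hz, ite_self]

theorem pastIntegral_alongLines_eq {Ω : Set (Space d)} {T : ℝ} {v : ℝ × Space d × Dir d → ℝ}
    {y : ℝ × Space d × Dir d} (hy : 0 ≤ y.1) :
    pastIntegral (alongLines Ω T v) y = ∫ z in 0..y.1, alongLines Ω T v (z, y.2) := by
  rw [intervalIntegral.integral_of_le hy, integral_Ioc_eq_integral_Ioo,
    ← integral_indicator measurableSet_Ioo, pastIntegral]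
  refine integral_congr_ae (Filter.Eventually.of_forall fun z => ?_)
  by_cases hz : 0 < z
  · simp [Set.indicator_apply, hz]
  · have h0 : alongLines Ω T v (z, y.2) = 0 := alongLines_of_notMem fun h => hz h.1
    simp [Set.indicator_apply, h0]

/-- The defect between a weak solution and the integral of its transport derivative along
characteristics is orthogonal to all test functions. -/
theorem integral_defect_eq_zero {Ω : Set (Space d)} (hΩ : IsOpen Ω) {T : ℝ} (hT : 0 < T)
    {u v : ℝ × Space d × Dir d → ℝ} {f : Space d × Dir d → ℝ} (hu : Measurable u)
    (hv : Measurable v) (hf : Measurable f) {M : ℝ} (hM0 : 0 ≤ M) (huM : ∀ y, |u y| ≤ M) (hvM : ∀ y, |v y| ≤ M)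
    (hfM : ∀ w, |f w| ≤ M) (h : HasTransportDerivAndTraces Ω T u v f)
    {g : ℝ × Space d × Space d → ℝ} (hg : ContDiff ℝ ((⊤ : ℕ∞) : WithTop ℕ∞) g)
    (hc : HasCompactSupport g)
    (hsupp : tsupport g ⊆ {q | q.1 ∈ Set.Ioo 0 T ∧ q.2.1 + q.1 • q.2.2 ∈ Ω}) :
    ∫ y, g (ambient y) * (alongLines Ω T u y - pastIntegral (alongLines Ω T v) y -
      (Ω ×ˢ Set.univ).indicator f y.2) ∂(lineMeasure d) = 0 := by
  set Φ := forwardIntegral g with hΦ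
  set V := alongLines Ω T v with hVdef
  set U := alongLines Ω T u with hUdef
  set f' := (Ω ×ˢ (Set.univ : Set (Dir d))).indicator f with hf'
  have hVm : Measurable V := measurable_alongLines hΩ T hv
  have hUm : Measurable U := measurable_alongLines hΩ T hu
  have hf'm : Measurable f' := hf.indicator (hΩ.measurableSet.prod MeasurableSet.univ)
  have hf'M : ∀ w, |f' w| ≤ M := fun w => by
    classical
    rw [hf', Set.indicator_apply]
    split_ifs
    · exact hfM w
    · simpa using (abs_nonneg _).trans (hfM w)
  have hVM : ∀ y, |V y| ≤ M := abs_alongLines_le hvM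
  have hUM : ∀ y, |U y| ≤ M := abs_alongLines_le huM
  have hgc : Continuous g := hg.continuous
  have hΦc : Continuous Φ := (contDiff_forwardIntegral hg hc).continuous
  have hamb : Measurable (ambient (d := d)) := measurableEmbedding_ambient.measurable
  have key := h _ (isTestFunction_lineTestFunction hg hc hsupp)
  -- the three integrals of the weak formulation, in characteristic coordinates
  have hχ : ∀ z : ℝ, 0 ≤ z → Real.smoothTransition (z + 2) = 1 := fun z hz =>
    Real.smoothTransition.one_of_one_le (by linarith)
  have e1 : ∫ y, u y * transportDeriv (lineTestFunction g) y ∂(phaseMeasure Ω T) =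
      ∫ y, U y * -g (ambient y) ∂(lineMeasure d) := by
    have : ∫ y, u y * transportDeriv (lineTestFunction g) y ∂(phaseMeasure Ω T) =
        ∫ y, u y * -g (y.1, y.2.1 - y.1 • (y.2.2 : Space d), (y.2.2 : Space d))
          ∂(phaseMeasure Ω T) := by
      rw [phaseMeasure_eq_restrict]
      refine setIntegral_congr_fun (measurableSet_phaseSet hΩ T) fun y hy => ?_
      simp only [transportDeriv_lineTestFunction hg hc hy.1.1]
    rw [this, integral_phaseMeasure hΩ T (by fun_prop)]
    refine integral_congr_ae (Filter.Eventually.of_forall fun y => ?_)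
    by_cases hy : shear y ∈ phaseSet Ω T
    · simp only [hUdef, alongLines_of_shear_mem hy]
      simp [shear, ambient]
    · simp only [hUdef, alongLines_of_shear_notMem hy, zero_mul]
  have e2 : ∫ y, v y * lineTestFunction g (y.1, y.2.1, (y.2.2 : Space d)) ∂(phaseMeasure Ω T) =
      ∫ y, V y * Φ (ambient y) ∂(lineMeasure d) := by
    have hLm : Measurable fun y : ℝ × Space d × Dir d =>
        v y * lineTestFunction g (y.1, y.2.1, (y.2.2 : Space d)) :=
      hv.mul ((contDiff_lineTestFunction hg hc).continuous.measurable.comp hamb)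
    rw [integral_phaseMeasure hΩ T hLm]
    refine integral_congr_ae (Filter.Eventually.of_forall fun y => ?_)
    by_cases hy : shear y ∈ phaseSet Ω T
    · have hz : 0 ≤ y.1 := hy.1.1.le
      simp only [hVdef, alongLines_of_shear_mem hy]
      simp [hΦ, shear, ambient, lineTestFunction, hχ _ hz]
    · simp only [hVdef, alongLines_of_shear_notMem hy, zero_mul]
  have e3 : ∫ w, f w * lineTestFunction g (0, w.1, (w.2 : Space d)) ∂(initialMeasure Ω) =
      ∫ w, f' w * Φ (0, w.1, (w.2 : Space d))
        ∂((volume : Measure (Space d)).prod (dirMeasure d)) := by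
    rw [initialMeasure_eq_restrict,
      ← integral_indicator (hΩ.measurableSet.prod MeasurableSet.univ)]
    refine integral_congr_ae (Filter.Eventually.of_forall fun w => ?_)
    by_cases hw : w ∈ Ω ×ˢ (Set.univ : Set (Dir d))
    · simp only [hf', Set.indicator_of_mem hw, lineTestFunction, hΦ, hχ 0 le_rfl, one_mul, zero_smul,
        sub_zero]
    · simp [hf', hw]
  -- bounds on the test functions
  obtain ⟨R, hR⟩ := hc.isCompact.isBounded.subset_closedBall (0 : ℝ × Space d × Space d)
  have hgR : ∀ q, g q ≠ 0 → |q.1| ≤ R ∧ ‖q.2.1‖ ≤ R := fun q hq => by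
    have hmem := hR (subset_tsupport _ hq)
    rw [mem_closedBall_zero_iff, norm_prod_le_iff, norm_prod_le_iff] at hmem
    exact ⟨hmem.1, hmem.2.1⟩
  have hg0 : ∀ q : ℝ × Space d × Space d, q.1 ∉ Set.Ioo 0 T → g q = 0 := fun q hq => by
    by_contra hne
    exact hq (hsupp (subset_tsupport _ hne)).1
  obtain ⟨C, hC⟩ := hgc.bounded_above_of_compact_support hc
  have hC0 : 0 ≤ C := (norm_nonneg _).trans (hC 0)
  have hgi : ∀ {r : ℝ × Space d × Dir d → ℝ}, Measurable r → ∀ {D : ℝ}, (∀ y, |r y| ≤ D) →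
      Integrable (fun y => g (ambient y) * r y) (lineMeasure d) := fun {r} hr D hD =>
    integrable_lineMeasure_of_bounded ((hgc.measurable.comp hamb).mul hr) (C := C * D) (R := R)
      (fun y => by rw [abs_mul]; exact mul_le_mul (hC _) (hD _) (abs_nonneg _) hC0)
      fun y hy => hgR _ (left_ne_zero_of_mul hy)
  have hΦC : ∀ q, |Φ q| ≤ C * T := fun q =>
    abs_integral_le_of_Ioo hT.le (fun s => by split_ifs <;> [exact hC _; simpa using hC0])
      fun s hs => by rw [hg0 _ hs, ite_self]
  have hΦR : ∀ q, Φ q ≠ 0 → ‖q.2.1‖ ≤ R := fun q hq => by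
    obtain ⟨s, _, hs⟩ := exists_of_forwardIntegral_ne_zero hq
    exact (hgR _ hs).2
  have hVΦi : Integrable (fun y => V y * Φ (ambient y)) (lineMeasure d) := by
    refine integrable_lineMeasure_of_bounded (hVm.mul (hΦc.measurable.comp hamb))
      (C := M * (C * T)) (R := max R T)
      (fun y => by rw [abs_mul]; exact mul_le_mul (hVM _) (hΦC _) (abs_nonneg _) hM0)
      fun y hy => ⟨?_, (hΦR _ (right_ne_zero_of_mul hy)).trans (le_max_left _ _)⟩
    have hz : y.1 ∈ Set.Ioo 0 T := by
      by_contra hcon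
      exact left_ne_zero_of_mul hy (alongLines_of_notMem hcon)
    rw [abs_of_pos hz.1]
    exact hz.2.le.trans (le_max_right _ _)
  have hPm := measurable_pastIntegral hVm
  have hPM : ∀ y, |pastIntegral V y| ≤ M * T := abs_pastIntegral_alongLines_le hT.le hvM
  -- Fubini on each line exchanges the forward integral of `g` with the past integral of `V`
  have e2' : ∫ y, V y * Φ (ambient y) ∂(lineMeasure d) =
      ∫ y, g (ambient y) * pastIntegral V y ∂(lineMeasure d) := by
    have h1 := hVΦi
    have h2 := hgi hPm hPM
    rw [lineMeasure] at h1 h2 ⊢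
    rw [integral_prod_symm _ h1, integral_prod_symm _ h2]
    refine integral_congr_ae (Filter.Eventually.of_forall fun w => ?_)
    set F : ℝ → ℝ → ℝ := fun z s => if z < s then V (z, w) * g (s, w.1, (w.2 : Space d)) else 0
      with hF
    have hFi : Integrable (Function.uncurry F) (volume.prod volume) := by
      have hFm : Measurable (Function.uncurry F) :=
        Measurable.ite (measurableSet_lt measurable_fst measurable_snd)
          ((hVm.comp (by fun_prop : Measurable fun p : ℝ × ℝ => (p.1, w))).mul
            (hgc.measurable.comp
              (by fun_prop : Measurable fun p : ℝ × ℝ => (p.2, w.1, (w.2 : Space d)))))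
          measurable_const
      refine (integrableOn_iff_integrable_of_support_subset
        (s := Set.Ioo 0 T ×ˢ Set.Ioo 0 T) fun p hp => ?_).1
        (Measure.integrableOn_of_bounded (M := M * C) ?_ hFm.aestronglyMeasurable
          (Filter.Eventually.of_forall fun p => ?_))
      · have hp' : F p.1 p.2 ≠ 0 := hp
        simp only [hF] at hp'
        split_ifs at hp' with hlt
        · refine ⟨?_, ?_⟩
          · by_contra hcon
            exact left_ne_zero_of_mul hp' (alongLines_of_notMem hcon)
          · by_contra hcon
            exact right_ne_zero_of_mul hp' (hg0 _ hcon)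
        · exact absurd rfl hp'
      · rw [Measure.prod_prod]
        exact (ENNReal.mul_lt_top (by simp) (by simp)).ne
      · change |F p.1 p.2| ≤ _
        simp only [hF]
        split_ifs
        · rw [abs_mul]
          exact mul_le_mul (hVM _) (hC _) (abs_nonneg _) hM0
        · simpa using mul_nonneg hM0 hC0
    calc ∫ z, V (z, w) * Φ (ambient (z, w)) = ∫ z, ∫ s, F z s := by
          refine integral_congr_ae (Filter.Eventually.of_forall fun z => ?_)
          simp only [hΦ, forwardIntegral, ambient, hF, ← integral_const_mul, mul_ite, mul_zero]
      _ = ∫ s, ∫ z, F z s := integral_integral_swap hFi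
      _ = ∫ s, g (ambient (s, w)) * pastIntegral V (s, w) := by
          refine integral_congr_ae (Filter.Eventually.of_forall fun s => ?_)
          simp only [pastIntegral, ambient, hF, ← integral_const_mul, mul_ite, mul_zero,
            mul_comm (V _)]
  have e3' : ∫ w, f' w * Φ (0, w.1, (w.2 : Space d))
      ∂((volume : Measure (Space d)).prod (dirMeasure d)) =
      ∫ y, g (ambient y) * f' y.2 ∂(lineMeasure d) := by
    have h2 : Integrable (fun y => g (ambient y) * f' y.2) (lineMeasure d) :=
      hgi (hf'm.comp measurable_snd) (fun y => hf'M y.2)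
    rw [lineMeasure] at h2 ⊢
    rw [integral_prod_symm _ h2]
    refine integral_congr_ae (Filter.Eventually.of_forall fun w => ?_)
    simp only [hΦ, forwardIntegral, ambient, ← integral_const_mul]
    refine integral_congr_ae (Filter.Eventually.of_forall fun s => ?_)
    by_cases hs : 0 < s
    · simp [hs, mul_comm]
    · have : g (s, w.1, (w.2 : Space d)) = 0 := hg0 _ fun h => hs h.1
      simp [this]
  rw [e1, e2, e3, e2', e3'] at key
  have hUi := hgi hUm hUM
  have hPi := hgi hPm hPM
  have hfi : Integrable (fun y => g (ambient y) * f' y.2) (lineMeasure d) :=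
    hgi (hf'm.comp measurable_snd) (fun y => hf'M y.2)
  simp only [mul_sub]
  have hUPi : Integrable (fun y => g (ambient y) * U y - g (ambient y) * pastIntegral V y)
    (lineMeasure d) := hUi.sub hPi
  rw [integral_sub hUPi hfi, integral_sub hUi hPi]
  have hneg : ∫ y, U y * -g (ambient y) ∂(lineMeasure d) =
      -∫ y, g (ambient y) * U y ∂(lineMeasure d) := by
    rw [← integral_neg]
    exact integral_congr_ae (Filter.Eventually.of_forall fun y => by ring)
  linarith

/-- The fundamental lemma of the calculus of variations on `ℝ × ℝ^d × S^{d-1}`, with test functions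
on the ambient space. -/
theorem ae_eq_zero_of_forall_ambient_test {r : ℝ × Space d × Dir d → ℝ} (hrm : Measurable r)
    {C : ℝ} (hrC : ∀ y, |r y| ≤ C) {U : Set (ℝ × Space d × Space d)} (hU : IsOpen U)
    (h : ∀ g : ℝ × Space d × Space d → ℝ, ContDiff ℝ ((⊤ : ℕ∞) : WithTop ℕ∞) g →
      HasCompactSupport g → tsupport g ⊆ U → ∫ y, g (ambient y) * r y ∂(lineMeasure d) = 0) :
    ∀ᵐ y ∂(lineMeasure d), ambient y ∈ U → r y = 0 := by
  have hemb := measurableEmbedding_ambient (d := d)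
  set μ' : Measure (ℝ × Space d × Space d) := (lineMeasure d).map ambient with hμ'
  have hfin : IsFiniteMeasureOnCompacts μ' := by
    refine ⟨fun K hK => ?_⟩
    obtain ⟨R, hR⟩ := hK.isBounded.subset_closedBall (0 : ℝ × Space d × Space d)
    rw [hμ', hemb.map_apply]
    refine lt_of_le_of_lt (b := lineMeasure d (Metric.closedBall (0 : ℝ) R ×ˢ
      Metric.closedBall (0 : Space d) R ×ˢ Set.univ)) (measure_mono fun y hy => ?_) ?_
    · have hmem := hR hy
      rw [mem_closedBall_zero_iff, norm_prod_le_iff, norm_prod_le_iff] at hmem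
      exact ⟨mem_closedBall_zero_iff.2 hmem.1, mem_closedBall_zero_iff.2 hmem.2.1, Set.mem_univ _⟩
    · rw [lineMeasure, Measure.prod_prod, Measure.prod_prod]
      exact ENNReal.mul_lt_top measure_closedBall_lt_top
        (ENNReal.mul_lt_top measure_closedBall_lt_top (measure_lt_top _ _))
  have hloc : IsLocallyFiniteMeasure μ' := isLocallyFiniteMeasure_of_isFiniteMeasureOnCompacts
  set r' : ℝ × Space d × Space d → ℝ := Function.extend ambient r 0 with hr'
  have hr'a : ∀ y, r' (ambient y) = r y := fun y => hemb.injective.extend_apply _ _ _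
  have hr'm : Measurable r' := hemb.measurable_extend hrm measurable_zero
  have hr'C : ∀ᵐ q ∂μ', ‖r' q‖ ≤ ‖C‖ := by
    rw [hμ', hemb.ae_map_iff]
    refine Filter.Eventually.of_forall fun y => ?_
    rw [hr'a]
    exact (hrC y).trans (le_abs_self _)
  have hli : LocallyIntegrable r' μ' :=
    (locallyIntegrable_const (C)).mono hr'm.aestronglyMeasurable hr'C
  have hae := hU.ae_eq_zero_of_integral_contDiff_smul_eq_zero (hli.locallyIntegrableOn _)
    (fun g hg hc hsupp => by
      rw [hμ', hemb.integral_map]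
      simp only [hr'a, smul_eq_mul]
      exact h g hg hc hsupp)
  rw [hμ', hemb.ae_map_iff] at hae
  filter_upwards [hae] with y hy hmem
  rw [← hr'a]
  exact hy hmem

/-- A weak solution is, almost everywhere, its initial value (or the zero inflow value) plus the
integral of its transport derivative along the characteristic line. -/
theorem ae_eq_add_integral_alongLines {Ω : Set (Space d)} (hΩ : IsOpen Ω) {T : ℝ} (hT : 0 < T)
    {u v : ℝ × Space d × Dir d → ℝ} {f : Space d × Dir d → ℝ} (hu : Measurable u)
    (hv : Measurable v) (hf : Measurable f) {M : ℝ} (hM0 : 0 ≤ M) (huM : ∀ y, |u y| ≤ M) (hvM : ∀ y, |v y| ≤ M)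
    (hfM : ∀ w, |f w| ≤ M) (h : HasTransportDerivAndTraces Ω T u v f) :
    ∀ᵐ y ∂(lineMeasure d), shear y ∈ phaseSet Ω T →
      u (shear y) = (Ω ×ˢ Set.univ).indicator f y.2 +
        ∫ z in 0..y.1, alongLines Ω T v (z, y.2) := by
  set r : ℝ × Space d × Dir d → ℝ := fun y => alongLines Ω T u y -
    pastIntegral (alongLines Ω T v) y - (Ω ×ˢ Set.univ).indicator f y.2 with hr
  have hrm : Measurable r :=
    ((measurable_alongLines hΩ T hu).sub
      (measurable_pastIntegral (measurable_alongLines hΩ T hv))).sub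
      ((hf.indicator (hΩ.measurableSet.prod MeasurableSet.univ)).comp measurable_snd)
  have hrM : ∀ y, |r y| ≤ M + M * T + M := fun y => by
    refine (abs_sub _ _).trans (add_le_add ((abs_sub _ _).trans (add_le_add ?_ ?_)) ?_)
    · exact abs_alongLines_le huM y
    · exact abs_pastIntegral_alongLines_le hT.le hvM y
    · classical
      rw [Set.indicator_apply]
      split_ifs
      · exact hfM _
      · simpa using (abs_nonneg _).trans (hfM y.2)
  have hopen : IsOpen {q : ℝ × Space d × Space d |
      q.1 ∈ Set.Ioo 0 T ∧ q.2.1 + q.1 • q.2.2 ∈ Ω} :=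
    (isOpen_Ioo.preimage continuous_fst).inter
      (hΩ.preimage (by fun_prop : Continuous fun q : ℝ × Space d × Space d => q.2.1 + q.1 • q.2.2))
  have hae := ae_eq_zero_of_forall_ambient_test hrm hrM hopen fun g hg hc hsupp =>
    integral_defect_eq_zero hΩ hT hu hv hf hM0 huM hvM hfM h hg hc hsupp
  filter_upwards [hae] with y hy hmem
  have h0 := hy ⟨hmem.1, hmem.2.1⟩
  have hU : alongLines Ω T u y = u (shear y) := alongLines_of_shear_mem hmem
  have hz : 0 ≤ y.1 := hmem.1.1.le
  simp only [hr, hU, pastIntegral_alongLines_eq hz] at h0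
  linarith

end Representation

/-! ### The entropy inequality -/

section Energy

variable {d : ℕ}

/-- A positive integrable weight on `(0,T) × ℝ^d` that decreases along all characteristics. -/
noncomputable def decayWeight (q : ℝ × Space d) : ℝ := (Real.exp (-q.1) * (1 + ‖q.2‖ ^ 2)⁻¹) ^ d

theorem decayWeight_pos (q : ℝ × Space d) : 0 < decayWeight q := by
  unfold decayWeight; positivity

theorem contDiff_decayWeight : ContDiff ℝ 1 (decayWeight (d := d)) := by
  unfold decayWeight
  refine ContDiff.pow (ContDiff.mul (by fun_prop) (ContDiff.inv ?_ fun q => by positivity)) d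
  exact contDiff_const.add (contDiff_snd.norm_sq ℝ)

theorem deriv_decayWeight_along_line_nonpos (ξ : Space d) (k : Dir d) (s : ℝ) :
    deriv (fun s => decayWeight (s, ξ + s • (k : Space d))) s ≤ 0 := by
  refine Antitone.deriv_nonpos ?_
  refine fun a b hab => pow_le_pow_left₀ (by positivity) ?_ d
  -- the derivative of `e^s (1 + |x|²)` along the line is `e^s |x + k|²`
  have hmono : Monotone fun s : ℝ => Real.exp s * (1 + ‖ξ + s • (k : Space d)‖ ^ 2) := by
    have hd : ∀ s : ℝ, HasDerivAt (fun s : ℝ => Real.exp s * (1 + ‖ξ + s • (k : Space d)‖ ^ 2))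
        (Real.exp s * ‖ξ + s • (k : Space d) + k‖ ^ 2) s := by
      intro s
      have h1 : HasDerivAt (fun s : ℝ => ξ + s • (k : Space d)) (k : Space d) s := by
        simpa using ((hasDerivAt_id s).smul_const (k : Space d)).const_add ξ
      refine ((Real.hasDerivAt_exp s).mul (h1.norm_sq.const_add 1)).congr_deriv ?_
      have hk : ‖(k : Space d)‖ = 1 := by simp
      rw [norm_add_sq_real (ξ + s • (k : Space d)) k, hk]
      ring
    refine monotone_of_deriv_nonneg (fun s => (hd s).differentiableAt) fun s => ?_
    rw [(hd s).deriv]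
    positivity
  have h := hmono hab
  simp only at h ⊢
  rw [Real.exp_neg, Real.exp_neg, ← mul_inv, ← mul_inv]
  exact inv_anti₀ (by positivity) h

theorem integrable_decayWeight (hd : 1 ≤ d) (Ω : Set (Space d)) (T : ℝ) :
    Integrable (decayWeight (d := d)) (spaceTimeMeasure Ω T) := by
  have h1 : Integrable (fun z : ℝ => Real.exp (-z) ^ d)
      ((volume : Measure ℝ).restrict (Set.Ioo 0 T)) :=
    ((by fun_prop : Continuous fun z : ℝ => Real.exp (-z) ^ d).integrableOn_Icc (a := 0)
      (b := T)).mono_set Set.Ioo_subset_Icc_self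
  have h2 : Integrable (fun x : Space d => ((1 + ‖x‖ ^ 2)⁻¹) ^ d)
      ((volume : Measure (Space d)).restrict Ω) := by
    have hd' : (0 : ℝ) < d := by exact_mod_cast hd
    have := integrable_rpow_neg_one_add_norm_sq (E := Space d) (μ := volume) (r := 2 * d)
      (by rw [finrank_euclideanSpace_fin]; linarith)
    refine (this.congr (Filter.Eventually.of_forall fun x => ?_)).integrableOn
    simp only
    rw [show -(2 * (d : ℝ)) / 2 = -d by ring, Real.rpow_neg (by positivity), Real.rpow_natCast,
      inv_pow]
  refine (h1.mul_prod h2).congr (Filter.Eventually.of_forall fun q => ?_)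
  simp [decayWeight, mul_pow]

theorem measurePreserving_prodAssoc_phaseMeasure (Ω : Set (Space d)) (T : ℝ) :
    MeasurePreserving (MeasurableEquiv.prodAssoc : (ℝ × Space d) × Dir d ≃ᵐ ℝ × Space d × Dir d)
      ((spaceTimeMeasure Ω T).prod (dirMeasure d)) (phaseMeasure Ω T) :=
  measurePreserving_prodAssoc _ _ _

instance (Ω : Set (Space d)) (T : ℝ) : SFinite (spaceTimeMeasure Ω T) := by
  unfold spaceTimeMeasure; infer_instance

theorem ae_ae_of_ae_phaseMeasure {Ω : Set (Space d)} {T : ℝ} {P : ℝ × Space d × Dir d → Prop}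
    (h : ∀ᵐ y ∂(phaseMeasure Ω T), P y) :
    ∀ᵐ q ∂(spaceTimeMeasure Ω T), ∀ᵐ k ∂(dirMeasure d), P (q.1, q.2, k) :=
  Measure.ae_ae_of_ae_prod
    ((measurePreserving_prodAssoc_phaseMeasure Ω T).quasiMeasurePreserving.ae h)

theorem integrable_prod_dirMeasure {Ω : Set (Space d)} {T : ℝ} {F : ℝ × Space d × Dir d → ℝ}
    (hF : Integrable F (phaseMeasure Ω T)) :
    Integrable (fun p : (ℝ × Space d) × Dir d => F (p.1.1, p.1.2, p.2))
      ((spaceTimeMeasure Ω T).prod (dirMeasure d)) :=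
  (measurePreserving_prodAssoc_phaseMeasure Ω T).integrable_comp_of_integrable hF

theorem integral_phaseMeasure_eq_integral_integral {Ω : Set (Space d)} {T : ℝ}
    {F : ℝ × Space d × Dir d → ℝ} (hF : Integrable F (phaseMeasure Ω T)) :
    ∫ y, F y ∂(phaseMeasure Ω T) =
      ∫ q, ∫ k, F (q.1, q.2, k) ∂(dirMeasure d) ∂(spaceTimeMeasure Ω T) := by
  rw [← (measurePreserving_prodAssoc_phaseMeasure Ω T).integral_comp'
    (g := F), ← integral_prod _ (integrable_prod_dirMeasure hF)]
  rfl

theorem ae_mem_phaseSet {Ω : Set (Space d)} (hΩ : IsOpen Ω) (T : ℝ) :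
    ∀ᵐ y ∂(phaseMeasure Ω T), y ∈ phaseSet Ω T := by
  rw [phaseMeasure_eq_restrict]
  exact ae_restrict_mem (measurableSet_phaseSet hΩ T)

theorem integrable_decayWeight_phaseMeasure (hd : 1 ≤ d) (Ω : Set (Space d)) (T : ℝ) :
    Integrable (fun y : ℝ × Space d × Dir d => decayWeight (y.1, y.2.1)) (phaseMeasure Ω T) := by
  have h := (integrable_decayWeight hd Ω T).comp_fst (dirMeasure d)
  exact ((measurePreserving_prodAssoc_phaseMeasure Ω T).integrable_comp_emb
    MeasurableEquiv.prodAssoc.measurableEmbedding).1 h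

/-- A weak solution `u` with transport derivative `v` and initial value `f`, given by everywhere
defined, measurable and bounded functions, with `u` positive everywhere. -/
structure IsRegularSolution (Ω : Set (Space d)) (T M : ℝ) (f : Space d × Dir d → ℝ)
    (u v : ℝ × Space d × Dir d → ℝ) : Prop where
  measurable_u : Measurable u
  measurable_v : Measurable v
  u_pos : ∀ y, 0 < u y
  u_le : ∀ y, u y ≤ M
  v_le : ∀ y, |v y| ≤ M
  transport : HasTransportDerivAndTraces Ω T u v f

/-- The transport derivative of the relative entropy of `w + δ` with respect to `u + δ`, when `v`
and `v'` are the transport derivatives of `u` and `w`. -/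
noncomputable def entropyRate (δ : ℝ) (u v w v' : ℝ × Space d × Dir d → ℝ)
    (y : ℝ × Space d × Dir d) : ℝ :=
  (Real.log (w y + δ) - Real.log (u y + δ)) * v' y + (1 - (w y + δ) / (u y + δ)) * v y

variable {Ω : Set (Space d)} {T M : ℝ} {f : Space d × Dir d → ℝ}
  {u v w v' : ℝ × Space d × Dir d → ℝ}

theorem IsRegularSolution.measurable_entropyRate (hu : IsRegularSolution Ω T M f u v)
    (hw : IsRegularSolution Ω T M f w v') (δ : ℝ) : Measurable (entropyRate δ u v w v') := by
  have h1 := hu.measurable_u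
  have h2 := hu.measurable_v
  have h3 := hw.measurable_u
  have h4 := hw.measurable_v
  unfold entropyRate
  exact ((((h3.add_const δ).log).sub ((h1.add_const δ).log)).mul h4).add
    ((measurable_const.sub ((h3.add_const δ).div (h1.add_const δ))).mul h2)

theorem IsRegularSolution.exists_entropyRate_bound (hu : IsRegularSolution Ω T M f u v)
    (hw : IsRegularSolution Ω T M f w v') {δ : ℝ} (hδ : 0 < δ) :
    ∃ C, ∀ y, |entropyRate δ u v w v' y| ≤ C := by
  set l := |Real.log δ| + |Real.log (M + δ)|
  refine ⟨(l + l) * M + (1 + (M + δ) / δ) * M, fun y => ?_⟩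
  have h1 := hu.u_pos y
  have h2 := hw.u_pos y
  have h3 := hu.u_le y
  have h4 := hw.u_le y
  have hquot : |1 - (w y + δ) / (u y + δ)| ≤ 1 + (M + δ) / δ := by
    refine (abs_sub _ _).trans (add_le_add (by simp) ?_)
    rw [abs_of_pos (by positivity)]
    exact div_le_div₀ (by linarith) (by linarith) hδ (by linarith)
  unfold entropyRate
  refine (abs_add_le _ _).trans (add_le_add ?_ ?_)
  · rw [abs_mul]
    refine mul_le_mul ((abs_sub _ _).trans (add_le_add ?_ ?_)) (hw.v_le y) (abs_nonneg _)
      (by positivity)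
    · exact abs_log_le_of_mem_Icc hδ (by linarith) (by linarith)
    · exact abs_log_le_of_mem_Icc hδ (by linarith) (by linarith)
  · rw [abs_mul]
    exact mul_le_mul hquot (hu.v_le y) (abs_nonneg _) ((abs_nonneg _).trans hquot)

theorem integrable_alongLines (hΩ : IsOpen Ω) {F : ℝ × Space d × Dir d → ℝ}
    (hF : Integrable F (phaseMeasure Ω T)) : Integrable (alongLines Ω T F) (lineMeasure d) := by
  rw [phaseMeasure_eq_restrict] at hF
  have h := (integrable_indicator_iff (measurableSet_phaseSet hΩ T)).2 hF
  exact measurePreserving_shear.integrable_comp_of_integrable h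

theorem IsRegularSolution.integrable_relEntropy (hd : 1 ≤ d)
    (hu : IsRegularSolution Ω T M f u v) (hw : IsRegularSolution Ω T M f w v') {δ : ℝ}
    (hδ : 0 < δ) :
    Integrable (fun y => relEntropy (w y + δ) (u y + δ) * decayWeight (y.1, y.2.1))
      (phaseMeasure Ω T) := by
  refine (integrable_decayWeight_phaseMeasure hd Ω T).bdd_mul (c := _) ?_
    (Filter.Eventually.of_forall fun y =>
      abs_relEntropy_le hδ (M := M + δ) (by linarith [hu.u_pos y]) (by linarith [hw.u_pos y])
        (by linarith [hu.u_le y]) (by linarith [hw.u_le y]))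
  have h1 := hu.measurable_u
  have h3 := hw.measurable_u
  unfold relEntropy
  fun_prop

theorem IsRegularSolution.integrable_entropyRate (hd : 1 ≤ d) (hΩ : IsOpen Ω)
    (hu : IsRegularSolution Ω T M f u v) (hw : IsRegularSolution Ω T M f w v') {δ : ℝ}
    (hδ : 0 < δ) :
    Integrable (fun y => entropyRate δ u v w v' y * ((T - y.1) * decayWeight (y.1, y.2.1)))
      (phaseMeasure Ω T) := by
  obtain ⟨C, hC⟩ := hu.exists_entropyRate_bound hw hδ
  refine Integrable.bdd_mul (c := C) ?_ (hu.measurable_entropyRate hw δ).aestronglyMeasurable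
    (Filter.Eventually.of_forall hC)
  refine (integrable_decayWeight_phaseMeasure hd Ω T).bdd_mul (c := T)
    (by fun_prop) ?_
  filter_upwards [ae_mem_phaseSet hΩ T] with y hy
  rw [Real.norm_eq_abs, abs_le]
  constructor <;> linarith [hy.1.1, hy.1.2]

/-- The entropy inequality in phase space: integrating the entropy balance over all characteristic
lines. The relative entropy vanishes where a line enters the domain, since both solutions have the
same initial and inflow values, and its non-negativity disposes of the outflow boundary. -/
theorem IsRegularSolution.integral_relEntropy_le_integral_entropyRate (hd : 1 ≤ d) (hΩ : IsOpen Ω)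
    (hT : 0 < T) (hM : 0 ≤ M) (hf : Measurable f) (hf0 : ∀ x, 0 ≤ f x) (hfM : ∀ x, f x ≤ M)
    (hu : IsRegularSolution Ω T M f u v) (hw : IsRegularSolution Ω T M f w v') {δ : ℝ}
    (hδ : 0 < δ) :
    ∫ y, relEntropy (w y + δ) (u y + δ) * decayWeight (y.1, y.2.1) ∂(phaseMeasure Ω T) ≤
      ∫ y, entropyRate δ u v w v' y * ((T - y.1) * decayWeight (y.1, y.2.1))
        ∂(phaseMeasure Ω T) := by
  set F₁ : ℝ × Space d × Dir d → ℝ := fun y =>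
    relEntropy (w y + δ) (u y + δ) * decayWeight (y.1, y.2.1) with hF₁
  set F₂ : ℝ × Space d × Dir d → ℝ := fun y =>
    entropyRate δ u v w v' y * ((T - y.1) * decayWeight (y.1, y.2.1)) with hF₂
  have hum := hu.measurable_u
  have hwm := hw.measurable_u
  have hηc : Continuous (decayWeight (d := d)) := contDiff_decayWeight.continuous
  have hF₁m : Measurable F₁ := by
    simp only [hF₁, relEntropy]
    fun_prop
  have hF₂m : Measurable F₂ := by
    have := hu.measurable_entropyRate hw δ
    fun_prop
  have hi1 := integrable_alongLines hΩ (hu.integrable_relEntropy hd hw hδ)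
  have hi2 := integrable_alongLines hΩ (hu.integrable_entropyRate hd hΩ hw hδ)
  rw [integral_phaseMeasure hΩ T hF₁m, integral_phaseMeasure hΩ T hF₂m]
  have habs : ∀ {h : ℝ × Space d × Dir d → ℝ}, (∀ y, 0 < h y) → (∀ y, h y ≤ M) → ∀ y, |h y| ≤ M :=
    fun h0 h1 y => by rw [abs_of_pos (h0 y)]; exact h1 y
  have hrep1 := ae_eq_add_integral_alongLines hΩ hT hum hu.measurable_v hf hM
    (habs hu.u_pos hu.u_le) hu.v_le
    (fun x => by rw [abs_of_nonneg (hf0 x)]; exact hfM x) hu.transport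
  have hrep2 := ae_eq_add_integral_alongLines hΩ hT hwm hw.measurable_v hf hM
    (habs hw.u_pos hw.u_le) hw.v_le
    (fun x => by rw [abs_of_nonneg (hf0 x)]; exact hfM x) hw.transport
  have hrep := hrep1.and hrep2
  have hline : ∀ᵐ p ∂((volume : Measure (Space d)).prod (dirMeasure d)), ∀ᵐ s : ℝ,
      shear (s, p) ∈ phaseSet Ω T →
        u (shear (s, p)) = (Ω ×ˢ Set.univ).indicator f p +
          ∫ z in 0..s, alongLines Ω T v (z, p) ∧
        w (shear (s, p)) = (Ω ×ˢ Set.univ).indicator f p +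
          ∫ z in 0..s, alongLines Ω T v' (z, p) := by
    rw [lineMeasure] at hrep
    have := (Measure.measurePreserving_swap
      (μ := (volume : Measure (Space d)).prod (dirMeasure d))
      (ν := (volume : Measure ℝ))).quasiMeasurePreserving.ae hrep
    filter_upwards [Measure.ae_ae_of_ae_prod this] with p hp
    filter_upwards [hp] with s hs hmem
    exact ⟨hs.1 hmem, hs.2 hmem⟩
  rw [lineMeasure] at hi1 hi2 ⊢
  rw [integral_prod_symm _ hi1, integral_prod_symm _ hi2]
  refine integral_mono_ae hi1.integral_prod_right hi2.integral_prod_right ?_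
  filter_upwards [hline] with p hp
  -- one characteristic line
  set J : Set ℝ := {s | shear (s, p) ∈ phaseSet Ω T} with hJ
  have hJT : J ⊆ Set.Ioo 0 T := fun s hs => hs.1
  set c := (Ω ×ˢ (Set.univ : Set (Dir d))).indicator f p with hc
  have hc0 : 0 ≤ c := Set.indicator_nonneg (fun x _ => hf0 x) p
  have hprim : ∀ {h : ℝ × Space d × Dir d → ℝ}, Measurable h → (∀ y, |h y| ≤ M) →
      ∀ a b : ℝ, IntervalIntegrable (fun s => alongLines Ω T h (s, p)) volume a b :=
    fun {h} hm hM' a b => by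
      have hfin : Integrable (fun s => alongLines Ω T h (s, p))
          (volume.restrict (Set.uIoc a b)) := by
        refine Measure.integrableOn_of_bounded (M := M) (by simp [Set.uIoc]) ?_
          (Filter.Eventually.of_forall fun s => abs_alongLines_le hM' (s, p))
        exact ((measurable_alongLines hΩ T hm).comp (by fun_prop)).aestronglyMeasurable
      exact intervalIntegrable_iff.2 hfin
  set V : ℝ → ℝ := fun s => alongLines Ω T v (s, p) with hV
  set W : ℝ → ℝ := fun s => alongLines Ω T v' (s, p) with hW
  have hVi : ∀ a b, IntervalIntegrable V volume a b := hprim hu.measurable_v hu.v_le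
  have hWi : ∀ a b, IntervalIntegrable W volume a b := hprim hw.measurable_v hw.v_le
  set A : ℝ → ℝ := fun s => c + ∫ z in 0..s, V z with hA
  set B : ℝ → ℝ := fun s => c + ∫ z in 0..s, W z with hB
  have hA0 : ∀ s ∈ Set.Icc 0 T, 0 ≤ A s := by
    refine primitive_nonneg hT hc0 (hVi _ _) (J := J)
      (fun s hs => alongLines_of_shear_notMem hs) ?_
    filter_upwards [hp] with s hs _ hsJ
    rw [← (hs hsJ).1]
    exact (hu.u_pos _).le
  have hB0 : ∀ s ∈ Set.Icc 0 T, 0 ≤ B s := by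
    refine primitive_nonneg hT hc0 (hWi _ _) (J := J)
      (fun s hs => alongLines_of_shear_notMem hs) ?_
    filter_upwards [hp] with s hs _ hsJ
    rw [← (hs hsJ).2]
    exact (hw.u_pos _).le
  set η : ℝ → ℝ := fun s => decayWeight (s, p.1 + s • (p.2 : Space d)) with hη
  have hηC : ContDiff ℝ 1 η := contDiff_decayWeight.comp (by fun_prop)
  set φ : ℝ → ℝ := fun s => (T - s) * η s with hφ
  have hφC : ContDiff ℝ 1 φ := (by fun_prop : ContDiff ℝ 1 fun s : ℝ => T - s).mul hηC
  have hφη : ∀ s ∈ Set.Icc 0 T, deriv φ s ≤ - η s := by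
    intro s hs
    have h1 : HasDerivAt η (deriv η s) s := (hηC.differentiable (by simp) s).hasDerivAt
    have h2 : HasDerivAt (fun s : ℝ => T - s) (-1) s := by
      simpa using (hasDerivAt_id s).const_sub T
    have h5 : deriv φ s = -1 * η s + (T - s) * deriv η s := (h2.mul h1).deriv
    rw [h5]
    have h3 : deriv η s ≤ 0 := deriv_decayWeight_along_line_nonpos p.1 p.2 s
    have h4 := mul_nonpos_of_nonneg_of_nonpos (sub_nonneg.2 hs.2) h3
    linarith
  have hφT : φ T = 0 := by simp [hφ]
  have key := integral_relEntropy_le hT hδ (hVi 0 T) (hWi 0 T) (A := A) (B := B)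
    (fun _ => rfl) (fun _ => rfl) hA0 hB0 hφC hηC.continuous hφη hφT
  have hAc : Continuous A := continuous_const.add (intervalIntegral.continuous_primitive hVi 0)
  have hBc : Continuous B := continuous_const.add (intervalIntegral.continuous_primitive hWi 0)
  have hleft : ∫ s, alongLines Ω T F₁ (s, p) ≤
      ∫ s in 0..T, relEntropy (B s + δ) (A s + δ) * η s := by
    rw [intervalIntegral.integral_of_le hT.le, ← integral_indicator measurableSet_Ioc]
    have hIi : IntegrableOn (fun s => relEntropy (B s + δ) (A s + δ) * η s) (Set.Ioc 0 T) := by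
      refine (ContinuousOn.integrableOn_Icc ?_).mono_set Set.Ioc_subset_Icc_self
      unfold relEntropy
      have h1 : ContinuousOn (fun s => Real.log (B s + δ)) (Set.Icc 0 T) :=
        (hBc.add continuous_const).continuousOn.log fun s hs => (by linarith [hB0 s hs] : 0 < B s + δ).ne'
      have h2 : ContinuousOn (fun s => Real.log (A s + δ)) (Set.Icc 0 T) :=
        (hAc.add continuous_const).continuousOn.log fun s hs => (by linarith [hA0 s hs] : 0 < A s + δ).ne'
      have h3 := hηC.continuous
      fun_prop
    refine integral_mono_of_nonneg (Filter.Eventually.of_forall fun s => ?_)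
      ((integrable_indicator_iff measurableSet_Ioc).2 hIi) ?_
    · refine Set.indicator_nonneg (fun y _ => ?_) _
      exact mul_nonneg (relEntropy_nonneg (by linarith [hu.u_pos y]) (by linarith [hw.u_pos y]))
        (decayWeight_pos _).le
    · filter_upwards [hp] with s hs
      by_cases hsJ : s ∈ J
      · have h1 := (hJT hsJ)
        rw [alongLines_of_shear_mem hsJ, Set.indicator_of_mem (show s ∈ Set.Ioc 0 T from ⟨h1.1, h1.2.le⟩)]
        simp only [hF₁]
        rw [(hs hsJ).1, (hs hsJ).2]
        exact le_rfl
      · rw [alongLines_of_shear_notMem hsJ]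
        refine Set.indicator_nonneg (fun t ht => ?_) _
        have ht' : t ∈ Set.Icc 0 T := ⟨ht.1.le, ht.2⟩
        exact mul_nonneg (relEntropy_nonneg (by linarith [hA0 t ht']) (by linarith [hB0 t ht']))
          (decayWeight_pos _).le
  have hright : ∫ s in 0..T, ((Real.log (B s + δ) - Real.log (A s + δ)) * W s +
        (1 - (B s + δ) / (A s + δ)) * V s) * φ s = ∫ s, alongLines Ω T F₂ (s, p) := by
    rw [intervalIntegral.integral_of_le hT.le, ← integral_indicator measurableSet_Ioc]
    refine integral_congr_ae ?_
    filter_upwards [hp] with s hs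
    by_cases hsJ : s ∈ J
    · have h1 := (hJT hsJ)
      have hVs : V s = v (shear (s, p)) := alongLines_of_shear_mem hsJ
      have hWs : W s = v' (shear (s, p)) := alongLines_of_shear_mem hsJ
      rw [alongLines_of_shear_mem hsJ, Set.indicator_of_mem (show s ∈ Set.Ioc 0 T from ⟨h1.1, h1.2.le⟩), hVs, hWs]
      simp only [hF₂, entropyRate]
      rw [(hs hsJ).1, (hs hsJ).2]
      rfl
    · have hVs : V s = 0 := alongLines_of_shear_notMem hsJ
      have hWs : W s = 0 := alongLines_of_shear_notMem hsJ
      rw [alongLines_of_shear_notMem hsJ, Set.indicator_apply_eq_zero]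
      intro _
      simp only [hVs, hWs, mul_zero, add_zero, zero_mul]
  exact hleft.trans (key.trans hright.le)

end Energy

/-! ### Uniqueness of the solution with given angular average -/

section Uniqueness

variable {d : ℕ} {Ω : Set (Space d)} {T M : ℝ} {f : Space d × Dir d → ℝ}
  {u v w v' : ℝ × Space d × Dir d → ℝ}

/-- Two solutions of linear transport equations with possibly different bounded absorption, the
same initial value and the same angular average coincide: their regularised relative entropy is
of the order of `δ log (1 / δ)`. -/
theorem IsRegularSolution.ae_eq_of_average_eq (hd : 1 ≤ d) (hΩ : IsOpen Ω) (hT : 0 < T)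
    (hM : 0 < M) (hf : Measurable f) (hf0 : ∀ x, 0 ≤ f x) (hfM : ∀ x, f x ≤ M)
    (hu : IsRegularSolution Ω T M f u v) (hw : IsRegularSolution Ω T M f w v')
    {Ss : ℝ} (hSs : 0 ≤ Ss) {p : ℝ → ℝ} (hp : IsPhaseFunction d p) {a b : ℝ × Space d → ℝ} {N : ℝ}
    (ha : ∀ᵐ q ∂(spaceTimeMeasure Ω T), 0 ≤ a q ∧ a q ≤ N)
    (hb : ∀ᵐ q ∂(spaceTimeMeasure Ω T), 0 ≤ b q ∧ b q ≤ N)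
    (heq : ∀ᵐ y ∂(phaseMeasure Ω T),
      v y + a (y.1, y.2.1) * u y + Ss * (u y - scattering p u y) = 0)
    (heq' : ∀ᵐ y ∂(phaseMeasure Ω T),
      v' y + b (y.1, y.2.1) * w y + Ss * (w y - scattering p w y) = 0)
    (hg : angularAverage u =ᵐ[spaceTimeMeasure Ω T] angularAverage w) :
    u =ᵐ[phaseMeasure Ω T] w := by
  obtain ⟨hpm, ⟨θ₁, θ₂, hθ₁, hθ⟩, hp1⟩ := hp
  set S := (dirMeasure d).real Set.univ with hS
  have hS0 : 0 ≤ S := measureReal_nonneg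
  set I := ∫ q, decayWeight q ∂(spaceTimeMeasure Ω T) with hI
  set ε : ℝ → ℝ := fun δ => (δ * (N * (Real.log (M + δ) - Real.log δ) + N) * S) * T with hε
  -- the production of entropy is controlled pointwise in `(z, x)`
  have hprod : ∀ δ : ℝ, 0 < δ →
      ∫ y, entropyRate δ u v w v' y * ((T - y.1) * decayWeight (y.1, y.2.1))
        ∂(phaseMeasure Ω T) ≤ ε δ * I := by
    intro δ hδ
    have hint := hu.integrable_entropyRate hd hΩ hw hδ
    rw [integral_phaseMeasure_eq_integral_integral hint, hI, ← integral_const_mul]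
    refine integral_mono_ae (integrable_prod_dirMeasure hint).integral_prod_left
      ((integrable_decayWeight hd Ω T).const_mul _) ?_
    have hq : ∀ᵐ q ∂(spaceTimeMeasure Ω T), q.1 ∈ Set.Ioo 0 T := by
      rw [spaceTimeMeasure]
      exact Measure.quasiMeasurePreserving_fst.ae (ae_restrict_mem measurableSet_Ioo)
    filter_upwards [ha, hb, ae_ae_of_ae_phaseMeasure heq, ae_ae_of_ae_phaseMeasure heq', hg, hq]
      with q ha hb heq heq' hg hq
    have hqm : Measurable fun k : Dir d => (q.1, q.2, k) := by fun_prop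
    obtain ⟨C, hC⟩ := hu.exists_entropyRate_bound hw hδ
    have h := integral_entropyProduction_le (μ := dirMeasure d)
      (q := fun k k' => p (inner ℝ (k : Space d) (k' : Space d))) (C := θ₂)
      (hpm.comp (by fun_prop)) (fun k k' => hθ₁.le.trans (hθ k k').1) (fun k k' => (hθ k k').2)
      (fun k k' => by rw [real_inner_comm]) hp1 (hu.measurable_u.comp hqm)
      (hw.measurable_u.comp hqm) hδ hSs ha.1 hb.1 (fun k => hu.u_pos _) (fun k => hw.u_pos _)
      (fun k => hu.u_le _) (fun k => hw.u_le _) hg heq heq'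
      (integrable_of_measurable_of_abs_le ((hu.measurable_entropyRate hw δ).comp hqm)
        (fun k => hC _))
    have hTq : 0 ≤ T - q.1 := sub_nonneg.2 hq.2.le
    have hlog : Real.log δ ≤ Real.log (M + δ) := Real.log_le_log hδ (by linarith)
    have h1 : ∫ k, entropyRate δ u v w v' (q.1, q.2, k) ∂(dirMeasure d) ≤
        δ * (N * (Real.log (M + δ) - Real.log δ) + N) * S := by
      refine h.trans ?_
      have hbN := hb.2
      have haN := ha.2
      have h0 := sub_nonneg.2 hlog
      gcongr
    have h2 : 0 ≤ δ * (N * (Real.log (M + δ) - Real.log δ) + N) * S := by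
      have hN : 0 ≤ N := ha.1.trans ha.2
      have := sub_nonneg.2 hlog
      positivity
    simp only [integral_mul_const]
    rw [← mul_assoc]
    refine mul_le_mul_of_nonneg_right ?_ (decayWeight_pos q).le
    calc _ ≤ (δ * (N * (Real.log (M + δ) - Real.log δ) + N) * S) * (T - q.1) :=
          mul_le_mul_of_nonneg_right h1 hTq
      _ ≤ ε δ := mul_le_mul_of_nonneg_left (by linarith [hq.1]) h2
  -- the weighted squared distance does not depend on the regularisation
  set D : ℝ × Space d × Dir d → ℝ := fun y => (w y - u y) ^ 2 * decayWeight (y.1, y.2.1) with hD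
  have hDi : Integrable D (phaseMeasure Ω T) := by
    refine (integrable_decayWeight_phaseMeasure hd Ω T).bdd_mul (c := M ^ 2)
      ((hw.measurable_u.sub hu.measurable_u).pow_const 2).aestronglyMeasurable
      (Filter.Eventually.of_forall fun y => ?_)
    rw [Real.norm_eq_abs, abs_pow]
    refine pow_le_pow_left₀ (abs_nonneg _) ?_ 2
    rw [abs_le]
    constructor <;> linarith [hu.u_pos y, hu.u_le y, hw.u_pos y, hw.u_le y]
  have hDδ : ∀ δ : ℝ, 0 < δ → ∫ y, D y ∂(phaseMeasure Ω T) ≤ 4 * (M + δ) * (ε δ * I) := by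
    intro δ hδ
    have h1 := (hu.integral_relEntropy_le_integral_entropyRate hd hΩ hT hM.le hf hf0 hfM hw
      hδ).trans (hprod δ hδ)
    calc ∫ y, D y ∂(phaseMeasure Ω T) ≤ ∫ y, 4 * (M + δ) *
          (relEntropy (w y + δ) (u y + δ) * decayWeight (y.1, y.2.1)) ∂(phaseMeasure Ω T) := by
          refine integral_mono hDi ((hu.integrable_relEntropy hd hw hδ).const_mul _) fun y => ?_
          have h2 := sq_sub_le_relEntropy (a := u y + δ) (b := w y + δ) (M := M + δ)
            (by linarith [hu.u_pos y]) (by linarith [hw.u_pos y]) (by linarith [hu.u_le y])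
            (by linarith [hw.u_le y])
          rw [show w y + δ - (u y + δ) = w y - u y by ring] at h2
          simp only [hD]
          rw [← mul_assoc]
          exact mul_le_mul_of_nonneg_right h2 (decayWeight_pos _).le
      _ ≤ 4 * (M + δ) * (ε δ * I) := by
          rw [integral_const_mul]
          exact mul_le_mul_of_nonneg_left h1 (by linarith)
  have hlim : Filter.Tendsto (fun δ : ℝ => 4 * (M + δ) * (ε δ * I)) (nhdsWithin 0 (Set.Ioi 0))
      (nhds 0) := by
    have hform : (fun δ : ℝ => 4 * (M + δ) * (ε δ * I)) = fun δ : ℝ =>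
        4 * (M + δ) * ((N * (δ * Real.log (M + δ) - δ * Real.log δ) + N * δ) * S * T * I) := by
      funext δ; simp only [hε]; ring
    rw [hform]
    have hlogc : ContinuousAt (fun δ : ℝ => Real.log (M + δ)) 0 :=
      (continuousAt_const.add continuousAt_id).log (by simpa using hM.ne')
    have hmul : ContinuousAt (fun δ : ℝ => δ * Real.log δ) 0 :=
      Real.continuous_mul_log.continuousAt
    have hc : ContinuousAt (fun δ : ℝ => 4 * (M + δ) *
        ((N * (δ * Real.log (M + δ) - δ * Real.log δ) + N * δ) * S * T * I)) 0 := by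
      fun_prop
    have := hc.tendsto.mono_left (nhdsWithin_le_nhds (s := Set.Ioi 0))
    simpa using this
  have hD0 : ∫ y, D y ∂(phaseMeasure Ω T) ≤ 0 :=
    ge_of_tendsto hlim (by filter_upwards [self_mem_nhdsWithin] with δ hδ using hDδ δ hδ)
  have hDnn : 0 ≤ D := fun y => mul_nonneg (sq_nonneg _) (decayWeight_pos _).le
  have hDz := (integral_eq_zero_iff_of_nonneg hDnn hDi).1 (le_antisymm hD0 (integral_nonneg hDnn))
  filter_upwards [hDz] with y hy
  have h1 : (w y - u y) ^ 2 = 0 := (mul_eq_zero.1 hy).resolve_right (decayWeight_pos _).ne'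
  have h2 : w y - u y = 0 := by simpa using h1
  linarith

/-- Test functions supported in the interior of `X` already determine the transport derivative. -/
theorem IsRegularSolution.transportDeriv_ae_eq (hΩ : IsOpen Ω)
    (hu : IsRegularSolution Ω T M f u v) (hw : IsRegularSolution Ω T M f w v')
    (huw : u =ᵐ[phaseMeasure Ω T] w) : v =ᵐ[phaseMeasure Ω T] v' := by
  have hXm := measurableSet_phaseSet hΩ T
  set r : ℝ × Space d × Dir d → ℝ := (phaseSet Ω T).indicator fun y => v y - v' y with hr
  have hvM : ∀ y, |v y - v' y| ≤ M + M := fun y =>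
    (abs_sub _ _).trans (add_le_add (hu.v_le y) (hw.v_le y))
  have hrM : ∀ y, |r y| ≤ M + M := fun y => by
    classical
    rw [hr, Set.indicator_apply]
    split_ifs
    · exact hvM y
    · simpa using (abs_nonneg _).trans (hvM y)
  have hrm : Measurable r := (hu.measurable_v.sub hw.measurable_v).indicator hXm
  have hU : IsOpen (Set.Ioo 0 T ×ˢ Ω ×ˢ (Set.univ : Set (Space d))) :=
    isOpen_Ioo.prod (hΩ.prod isOpen_univ)
  have hae := ae_eq_zero_of_forall_ambient_test hrm hrM hU fun g hgs hgc hsupp => by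
    have hg0 : ∀ q, q ∉ Set.Ioo 0 T ×ˢ Ω ×ˢ (Set.univ : Set (Space d)) → g q = 0 := fun q hq => by
      by_contra hne
      exact hq (hsupp (subset_tsupport _ hne))
    have htest : IsTestFunction Ω T g :=
      { smooth := hgs
        compact_support := hgc
        final := fun x _ k => hg0 _ fun h => lt_irrefl _ h.1.2
        outflow := fun z _ x hx k n _ _ => hg0 _ fun h => by
          rw [hΩ.frontier_eq] at hx
          exact hx.2 h.2.1 }
    obtain ⟨R, hR⟩ := hgc.isCompact.isBounded.subset_closedBall (0 : ℝ × Space d × Space d)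
    obtain ⟨C, hC⟩ := hgs.continuous.bounded_above_of_compact_support hgc
    have hgi : ∀ {h : ℝ × Space d × Dir d → ℝ}, Measurable h → (∀ y, |h y| ≤ M) →
        Integrable (fun y => h y * g (ambient y)) (phaseMeasure Ω T) := fun {h} hm hM => by
      rw [phaseMeasure_eq_restrict]
      refine (integrable_lineMeasure_of_bounded (C := M * C) (R := R)
        (hm.mul (hgs.continuous.measurable.comp measurableEmbedding_ambient.measurable))
        (fun y => ?_) fun y hy => ?_).integrableOn
      · change |h y * g (ambient y)| ≤ _
        rw [abs_mul]
        exact mul_le_mul (hM y) (hC _) (abs_nonneg _) ((abs_nonneg _).trans (hM y))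
      · have hmem := hR (subset_tsupport _ (right_ne_zero_of_mul hy))
        rw [mem_closedBall_zero_iff, norm_prod_le_iff, norm_prod_le_iff] at hmem
        exact ⟨hmem.1, hmem.2.1⟩
    have h1 := hu.transport g htest
    have h2 := hw.transport g htest
    have h3 : ∫ y, u y * transportDeriv g y ∂(phaseMeasure Ω T) =
        ∫ y, w y * transportDeriv g y ∂(phaseMeasure Ω T) := by
      refine integral_congr_ae ?_
      filter_upwards [huw] with y hy
      rw [hy]
    have h4 : ∫ y, v y * g (ambient y) ∂(phaseMeasure Ω T) =
        ∫ y, v' y * g (ambient y) ∂(phaseMeasure Ω T) := by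
      simp only [ambient]
      linarith
    have h5 : ∫ y, (v y - v' y) * g (ambient y) ∂(phaseMeasure Ω T) = 0 := by
      simp only [sub_mul]
      rw [integral_sub (hgi hu.measurable_v hu.v_le) (hgi hw.measurable_v hw.v_le), h4, sub_self]
    rw [phaseMeasure_eq_restrict, ← integral_indicator hXm] at h5
    rw [← h5]
    refine integral_congr_ae (Filter.Eventually.of_forall fun y => ?_)
    by_cases hy : y ∈ phaseSet Ω T
    · simp only [hr, Set.indicator_of_mem hy]
      ring
    · simp only [hr, Set.indicator_of_notMem hy, mul_zero]
  rw [phaseMeasure_eq_restrict]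
  filter_upwards [ae_restrict_of_ae hae, ae_restrict_mem hXm] with y hy hmem
  have h1 := hy ⟨hmem.1, hmem.2.1, Set.mem_univ _⟩
  rw [hr, Set.indicator_of_mem hmem] at h1
  linarith

end Uniqueness

/-! ### Passage to everywhere defined representatives -/

section Representatives

variable {d : ℕ} {Ω : Set (Space d)} {T : ℝ}

theorem exists_forall_ge_ae_abs_le_of_memLp_top {α : Type*} [MeasurableSpace α] {μ : Measure α}
    {h : α → ℝ} (hh : MemLp h ⊤ μ) : ∃ C, ∀ M, C ≤ M → ∀ᵐ y ∂μ, |h y| ≤ M := by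
  refine ⟨(eLpNorm h ⊤ μ).toReal, fun M hM => ?_⟩
  have h1 : ∀ᵐ y ∂μ, ‖h y‖ₑ ≤ eLpNorm h ⊤ μ := by
    rw [eLpNorm_exponent_top]; exact ae_le_eLpNormEssSup
  filter_upwards [h1] with y hy
  have := ENNReal.toReal_mono hh.2.ne hy
  rw [toReal_enorm] at this
  exact this.trans hM

/-- A positive essentially bounded weak solution of the transport equation has a representative
that is measurable, bounded and positive everywhere. -/
theorem exists_isRegularSolution {M : ℝ} (hM : 0 < M) {f f₀ : Space d × Dir d → ℝ}
    (hf : f =ᵐ[initialMeasure Ω] f₀) {u v : ℝ × Space d × Dir d → ℝ}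
    (hum : AEMeasurable u (phaseMeasure Ω T)) (hvm : AEMeasurable v (phaseMeasure Ω T))
    (hu0 : ∀ᵐ y ∂(phaseMeasure Ω T), 0 < u y) (huM : ∀ᵐ y ∂(phaseMeasure Ω T), |u y| ≤ M)
    (hvM : ∀ᵐ y ∂(phaseMeasure Ω T), |v y| ≤ M) (h : HasTransportDerivAndTraces Ω T u v f) :
    ∃ u₀ v₀ : ℝ × Space d × Dir d → ℝ, u =ᵐ[phaseMeasure Ω T] u₀ ∧ v =ᵐ[phaseMeasure Ω T] v₀ ∧
      IsRegularSolution Ω T M f₀ u₀ v₀ := by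
  obtain ⟨u₀, hu₀m, hu₀r, hu₀⟩ := hum.exists_ae_eq_range_subset (t := Set.Ioc 0 M)
    (by filter_upwards [hu0, huM] with y h1 h2 using ⟨h1, (le_abs_self _).trans h2⟩)
    ⟨M, hM, le_rfl⟩
  obtain ⟨v₀, hv₀m, hv₀r, hv₀⟩ := hvm.exists_ae_eq_range_subset (t := Set.Icc (-M) M)
    (by filter_upwards [hvM] with y h2 using abs_le.1 h2) ⟨0, by simp [hM.le]⟩
  refine ⟨u₀, v₀, hu₀, hv₀, hu₀m, hv₀m, fun y => (hu₀r ⟨y, rfl⟩).1, fun y => (hu₀r ⟨y, rfl⟩).2,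
    fun y => abs_le.2 (hv₀r ⟨y, rfl⟩), fun φ hφ => ?_⟩
  have e1 : ∫ y, u₀ y * transportDeriv φ y ∂(phaseMeasure Ω T) =
      ∫ y, u y * transportDeriv φ y ∂(phaseMeasure Ω T) :=
    integral_congr_ae (by filter_upwards [hu₀] with y hy; rw [hy])
  have e2 : ∫ y, v₀ y * φ (y.1, y.2.1, (y.2.2 : Space d)) ∂(phaseMeasure Ω T) =
      ∫ y, v y * φ (y.1, y.2.1, (y.2.2 : Space d)) ∂(phaseMeasure Ω T) :=
    integral_congr_ae (by filter_upwards [hv₀] with y hy; rw [hy])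
  have e3 : ∫ x, f₀ x * φ (0, x.1, (x.2 : Space d)) ∂(initialMeasure Ω) =
      ∫ x, f x * φ (0, x.1, (x.2 : Space d)) ∂(initialMeasure Ω) :=
    integral_congr_ae (by filter_upwards [hf] with y hy; rw [hy])
  rw [e1, e2, e3]
  exact h φ hφ

theorem angularAverage_congr_ae {u u₀ : ℝ × Space d × Dir d → ℝ}
    (h : u =ᵐ[phaseMeasure Ω T] u₀) :
    angularAverage u =ᵐ[spaceTimeMeasure Ω T] angularAverage u₀ := by
  filter_upwards [ae_ae_of_ae_phaseMeasure h] with q hq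
  exact integral_congr_ae hq

theorem ae_phaseMeasure_of_ae_spaceTimeMeasure {P : ℝ × Space d → Prop}
    (h : ∀ᵐ q ∂(spaceTimeMeasure Ω T), P q) : ∀ᵐ y ∂(phaseMeasure Ω T), P (y.1, y.2.1) := by
  have h1 : ∀ᵐ z ∂((spaceTimeMeasure Ω T).prod (dirMeasure d)), P z.1 :=
    Measure.quasiMeasurePreserving_fst.ae h
  exact ((measurePreserving_prodAssoc_phaseMeasure Ω T).symm _).quasiMeasurePreserving.ae h1

theorem scattering_congr_ae {p : ℝ → ℝ} {u u₀ : ℝ × Space d × Dir d → ℝ}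
    (h : u =ᵐ[phaseMeasure Ω T] u₀) : scattering p u =ᵐ[phaseMeasure Ω T] scattering p u₀ := by
  filter_upwards [ae_phaseMeasure_of_ae_spaceTimeMeasure (ae_ae_of_ae_phaseMeasure h)] with y hy
  refine integral_congr_ae ?_
  filter_upwards [hy] with k hk
  exact congrArg _ hk

theorem exists_absorption_bound {L : ℕ} {σ : Fin (L + 1) → ℝ × Space d → ℝ}
    (hσ : IsAdmissibleAbsorption Ω T σ) {m : ℝ × Space d → ℝ} {B : ℝ}
    (hm : ∀ᵐ q ∂(spaceTimeMeasure Ω T), 0 ≤ m q ∧ m q ≤ B) :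
    ∃ N, ∀ᵐ q ∂(spaceTimeMeasure Ω T), 0 ≤ absorption σ m q ∧ absorption σ m q ≤ N := by
  choose C hC using fun l => exists_forall_ge_ae_abs_le_of_memLp_top (hσ l).1
  refine ⟨∑ l : Fin (L + 1), C l * B ^ (l : ℕ), ?_⟩
  have h1 : ∀ᵐ q ∂(spaceTimeMeasure Ω T), ∀ l, |σ l q| ≤ C l :=
    ae_all_iff.2 fun l => hC l _ le_rfl
  have h2 : ∀ᵐ q ∂(spaceTimeMeasure Ω T), ∀ l, 0 ≤ σ l q := ae_all_iff.2 fun l => (hσ l).2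
  filter_upwards [hm, h1, h2] with q hm h1 h2
  refine ⟨Finset.sum_nonneg fun l _ => mul_nonneg (h2 l) (pow_nonneg hm.1 _),
    Finset.sum_le_sum fun l _ => ?_⟩
  exact mul_le_mul ((le_abs_self _).trans (h1 l)) (pow_le_pow_left₀ hm.1 hm.2 _)
    (pow_nonneg hm.1 _) ((abs_nonneg _).trans (h1 l))

theorem IsRegularSolution.angularAverage_mem {M : ℝ} {f : Space d × Dir d → ℝ}
    {u v : ℝ × Space d × Dir d → ℝ} (hu : IsRegularSolution Ω T M f u v) (q : ℝ × Space d) :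
    0 ≤ angularAverage u q ∧ angularAverage u q ≤ M * (dirMeasure d).real Set.univ := by
  refine ⟨integral_nonneg fun k => (hu.u_pos _).le, ?_⟩
  have hi : Integrable (fun k => u (q.1, q.2, k)) (dirMeasure d) :=
    integrable_of_measurable_of_abs_le (hu.measurable_u.comp (by fun_prop)) (C := M) fun k => by
      rw [abs_of_pos (hu.u_pos _)]; exact hu.u_le _
  calc angularAverage u q ≤ ∫ _, M ∂(dirMeasure d) :=
        integral_mono hi (integrable_const M) fun k => hu.u_le _
    _ = M * (dirMeasure d).real Set.univ := by
        rw [integral_const, smul_eq_mul, mul_comm]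

end Representatives

end TransportInverse

open TransportInverse in
theorem mainTheorem4 (d : ℕ) (hd : 1 ≤ d)
    (Ω : Set (Space d)) (hΩ_open : IsOpen Ω) (hΩ_convex : Convex ℝ Ω)
    (hΩ_smooth : HasSmoothBoundary Ω)
    (T : ℝ) (hT : 0 < T)
    (Ss : ℝ) (hSs : 0 < Ss)
    (p : ℝ → ℝ) (hp : IsPhaseFunction d p)
    (L : ℕ) (σ σ' : Fin (L + 1) → ℝ × Space d → ℝ)
    (hσ : IsAdmissibleAbsorption Ω T σ) (hσ' : IsAdmissibleAbsorption Ω T σ')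
    (f : Space d × Dir d → ℝ) (hf : MemLp f ⊤ (initialMeasure Ω))
    (hf_pos : ∀ᵐ w ∂(initialMeasure Ω), 0 < f w)
    (u u' : ℝ × Space d × Dir d → ℝ)
    (hu : IsSolution Ω T σ Ss p f u) (hu' : IsSolution Ω T σ' Ss p f u')
    (hu_pos : ∀ᵐ y ∂(phaseMeasure Ω T), 0 < u y)
    (hu'_pos : ∀ᵐ y ∂(phaseMeasure Ω T), 0 < u' y)
    (hg : angularAverage u =ᵐ[spaceTimeMeasure Ω T] angularAverage u') :
    absorption σ (angularAverage u) =ᵐ[spaceTimeMeasure Ω T]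
      absorption σ' (angularAverage u') := by
  obtain ⟨hu1, v, hv1, htr, heq⟩ := hu
  obtain ⟨hu1', v', hv1', htr', heq'⟩ := hu'
  -- a common bound for all the data
  obtain ⟨C1, hC1⟩ := exists_forall_ge_ae_abs_le_of_memLp_top hu1
  obtain ⟨C2, hC2⟩ := exists_forall_ge_ae_abs_le_of_memLp_top hv1
  obtain ⟨C3, hC3⟩ := exists_forall_ge_ae_abs_le_of_memLp_top hu1'
  obtain ⟨C4, hC4⟩ := exists_forall_ge_ae_abs_le_of_memLp_top hv1'
  obtain ⟨C5, hC5⟩ := exists_forall_ge_ae_abs_le_of_memLp_top hf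
  obtain ⟨M, hM, h1, h2, h3, h4, h5⟩ :
      ∃ M : ℝ, 0 < M ∧ C1 ≤ M ∧ C2 ≤ M ∧ C3 ≤ M ∧ C4 ≤ M ∧ C5 ≤ M := by
    refine ⟨|C1| + |C2| + |C3| + |C4| + |C5| + 1, by positivity, ?_, ?_, ?_, ?_, ?_⟩ <;>
    linarith [le_abs_self C1, le_abs_self C2, le_abs_self C3, le_abs_self C4, le_abs_self C5,
      abs_nonneg C1, abs_nonneg C2, abs_nonneg C3, abs_nonneg C4, abs_nonneg C5]
  -- everywhere defined representatives
  obtain ⟨f₀, hf₀m, hf₀r, hf₀⟩ := hf.1.aemeasurable.exists_ae_eq_range_subset (t := Set.Icc 0 M)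
    (by filter_upwards [hf_pos, hC5 M h5] with x h1 h2 using ⟨h1.le, (le_abs_self _).trans h2⟩)
    ⟨0, le_rfl, hM.le⟩
  obtain ⟨u₀, v₀, hu₀, hv₀, hR⟩ := exists_isRegularSolution hM hf₀ hu1.1.aemeasurable
    hv1.1.aemeasurable hu_pos (hC1 M h1) (hC2 M h2) htr
  obtain ⟨w₀, v₀', hw₀, hv₀', hR'⟩ := exists_isRegularSolution hM hf₀ hu1'.1.aemeasurable
    hv1'.1.aemeasurable hu'_pos (hC3 M h3) (hC4 M h4) htr'
  have hav := angularAverage_congr_ae hu₀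
  have hav' := angularAverage_congr_ae hw₀
  set a := absorption σ (angularAverage u) with ha
  set b := absorption σ' (angularAverage u') with hb
  obtain ⟨N, hN⟩ := exists_absorption_bound hσ (m := angularAverage u)
    (by filter_upwards [hav] with q hq; rw [hq]; exact hR.angularAverage_mem q)
  obtain ⟨N', hN'⟩ := exists_absorption_bound hσ' (m := angularAverage u')
    (by filter_upwards [hav'] with q hq; rw [hq]; exact hR'.angularAverage_mem q)
  have heq₀ : ∀ᵐ y ∂(phaseMeasure Ω T),
      v₀ y + a (y.1, y.2.1) * u₀ y + Ss * (u₀ y - scattering p u₀ y) = 0 := by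
    filter_upwards [heq, hu₀, hv₀, scattering_congr_ae (p := p) hu₀] with y h1 h2 h3 h4
    rw [← h2, ← h3, ← h4]; exact h1
  have heq₀' : ∀ᵐ y ∂(phaseMeasure Ω T),
      v₀' y + b (y.1, y.2.1) * w₀ y + Ss * (w₀ y - scattering p w₀ y) = 0 := by
    filter_upwards [heq', hw₀, hv₀', scattering_congr_ae (p := p) hw₀] with y h1 h2 h3 h4
    rw [← h2, ← h3, ← h4]; exact h1
  have huw : u₀ =ᵐ[phaseMeasure Ω T] w₀ :=
    hR.ae_eq_of_average_eq hd hΩ_open hT hM hf₀m (fun x => (hf₀r ⟨x, rfl⟩).1)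
      (fun x => (hf₀r ⟨x, rfl⟩).2) hR' hSs.le hp (N := max N N')
      (hN.mono fun q hq => ⟨hq.1, hq.2.trans (le_max_left _ _)⟩)
      (hN'.mono fun q hq => ⟨hq.1, hq.2.trans (le_max_right _ _)⟩) heq₀ heq₀'
      (hav.symm.trans (hg.trans hav'))
  have hvv := hR.transportDeriv_ae_eq hΩ_open hR' huw
  have hab : ∀ᵐ y ∂(phaseMeasure Ω T), a (y.1, y.2.1) = b (y.1, y.2.1) := by
    filter_upwards [heq₀, heq₀', huw, hvv, scattering_congr_ae (p := p) huw] with y h1 h2 h3 h4 h5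
    rw [← h3, ← h4, ← h5] at h2
    exact mul_right_cancel₀ (hR.u_pos y).ne' (by linarith)
  -- the sphere has positive measure since `d ≥ 1`
  have hne : dirMeasure d ≠ 0 := by
    rw [dirMeasure, Ne, Measure.toSphere_eq_zero_iff_finrank, finrank_euclideanSpace_fin]
    omega
  have : NeZero (dirMeasure d) := ⟨hne⟩
  filter_upwards [ae_ae_of_ae_phaseMeasure hab] with q hq
  exact hq.exists.choose_spec
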